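/- **Setting.** Let $\theta$ be a finite positive Borel measure on $[-1,1]$ whose support is infinite, let $a_1,\dots,a_m\in[-1,1]$ with $\theta(\{a_k\})=0$, let $N_k\ge 0$ be integers, and let $M_{k,i}\ge 0$ $(0\le i<N_k)$, $M_{k,N_k}>0$. Put $$\langle f,g\rangle=\int_{-1}^1 fg\,d\theta+\sum_{k=1}^m\sum_{i=0}^{N_k}M_{k,i}f^{(i)}(a_k)g^{(i)}(a_k),$$ where derivatives are those of functions on $[-1,1]$ (one-sided at $\pm1$). Let $\widehat q_n$ $(n\ge0)$ be the polynomials of degree $n$ with positive leading coefficient that are orthonormal for $\langle\cdot,\cdot\rangle$. For $1\le p<\infty$ let $\mathfrak R_p$ be the set of $f$ with $\int_{-1}^1|f|^p\,d\theta<\infty$ such that $f^{(i)}(a_k)$ exists for $0\le i\le N_k$, $1\le k\le m$; for $f\in\mathfrak R_p$ put $c_k(f)=\langle f,\widehat q_k\rangle$. Let $N_k^*=N_k+1$ if $N_k$ is odd and $N_k^*=N_k+2$ if $N_k$ is even, $N=\sum_k N_k^*$, $w_N(x)=\prod_k(x-a_k)^{N_k^*}$, $\pi_{N+1}(x)=\int_{-1}^x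 w_N(t)\,dt$, and let $d_{n,j}$ be the coefficients of the recurrence relation $$\pi_{N+1}\widehat q_n=\sum_{j=0}^{N+1}d_{n+j,j}\,\widehat q_{n+j}+\sum_{j=1}^{N+1}d_{n,j}\,\widehat q_{n-j},$$ that is, $d_{n,j}=\langle \pi_{N+1}\widehat q_n,\widehat q_{n-j}\rangle$ for $j\le n$ and $d_{n,j}=0$ for $n<j$. Let $\varepsilon_m=(-1,1)\setminus\{a_1,\dots,a_m\}$. A point $x$ is called a Lebesgue point of $f$ if $\lim_{r\to0+}\frac1r\int_{[x-r,x+r]}|f(t)-f(x)|\,d\theta(t)=0$. **Theorem.** Suppose that $h$ is a real function with $|\widehat q_k(t)|\le h(t)$ for all $k\ge0$ and $t\in\varepsilon_m$, and that $$\sum_{j=1}^{N+1}j\sum_{l=0}^{N+1}\sum_{s=0}^\infty\bigl(|d_{s+j,j}-d_{s+j+l,j}|+|d_{s+l,l}-d_{s+j+l,l}|\bigr)<\infty.$$ Let $(\phi_k)_{k\ge0}$ be a real sequence with $\phi_0=1$ that is quasiconvex, i.e. $\sum_{k\ge0}(k+1)|\phi_k-2\phi_{k+1}+\phi_{k+2}|<\infty$,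 and satisfies $\phi_k=O(1/\ln k)$. Let $1\le p<\infty$ and let $f\in\mathfrak R_p$ satisfy $$\int_{-1}^1|f|^p|h|^p\,d\theta<\infty,\qquad \int_{-1}^1|h|^p\,d\theta<\infty.$$ (i) The series $\sum_{k=0}^\infty\phi_kc_k(f)\widehat q_k(x)$ converges at every Lebesgue point $x\in\varepsilon_m$ of $f$ near which $h$ is bounded; moreover (without any local boundedness of $h$) it converges at almost every $x\in\varepsilon_m$ with respect to Lebesgue measure. (ii) If, in addition, $f$ is continuous on $[-1,1]$, $h$ is locally bounded on $\varepsilon_m$, and $d\theta(x)=\omega(x)\,dx$ with $\omega\ge0$ continuous on $\varepsilon_m$, then the series converges uniformly on every compact subset $K\subset\varepsilon_m$. -/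

import Mathlib

open MeasureTheory Set Filter Topology Asymptotics

noncomputable section

/-- Data of a continuous-discrete Sobolev inner product on `[-1, 1]`: a finite positive Borel
measure `θ` carried by `[-1, 1]` with infinitely many points of increase, mass points
`a k ∈ [-1, 1]` with `θ {a k} = 0`, the orders `ord k` (written `N_k`) and the weights `M k i`. -/
structure SobolevData where
  m : ℕ
  θ : Measure ℝ
  finite : IsFiniteMeasure θ
  carried : θ (Icc (-1 : ℝ) 1)ᶜ = 0
  infinite_support : θ.support.Infinite
  a : Fin m → ℝ
  a_mem : ∀ k, a k ∈ Icc (-1 : ℝ) 1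
  θ_a : ∀ k, θ {a k} = 0
  ord : Fin m → ℕ
  M : Fin m → ℕ → ℝ
  M_nonneg : ∀ k, ∀ i < ord k, 0 ≤ M k i
  M_pos : ∀ k, 0 < M k (ord k)

/-- The `i`-th derivative `f^{(i)}(x)` of a function on `[-1, 1]` (one-sided at the endpoints). -/
def derivI (i : ℕ) (f : ℝ → ℝ) (x : ℝ) : ℝ :=
  iteratedDerivWithin i f (Icc (-1 : ℝ) 1) x

/-- `f^{(i)}(x)` exists, for a function on `[-1, 1]`: `f^{(i-1)}` exists near `x` in `[-1, 1]` and
is differentiable at `x`. -/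
def DerivExists (f : ℝ → ℝ) : ℕ → ℝ → Prop
  | 0, _ => True
  | i + 1, x => (∀ᶠ y in 𝓝[Icc (-1 : ℝ) 1] x, DerivExists f i y) ∧
      DifferentiableWithinAt ℝ (derivI i f) (Icc (-1 : ℝ) 1) x

/-- `φ` is quasiconvex (normalized by `φ 0 = 1`). -/
def IsQuasiconvex (φ : ℕ → ℝ) : Prop :=
  φ 0 = 1 ∧ Summable fun k : ℕ => ((k : ℝ) + 1) * |φ k - 2 * φ (k + 1) + φ (k + 2)|

/-- `x` is a Lebesgue point of `f` for the measure `μ` on the line: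
`(1/r) ∫_{x-r}^{x+r} |f(t) - f(x)| dμ(t) → 0` as `r → 0+`. -/
def IsLebesguePoint (μ : Measure ℝ) (f : ℝ → ℝ) (x : ℝ) : Prop :=
  Tendsto (fun r : ℝ => r⁻¹ * ∫ t in Icc (x - r) (x + r), |f t - f x| ∂μ) (𝓝[>] 0) (𝓝 0)

namespace SobolevData

variable (S : SobolevData)

/-- The inner product `⟨f, g⟩ = ∫ f g dθ + ∑_k ∑_{i ≤ N_k} M_{k,i} f^{(i)}(a_k) g^{(i)}(a_k)`. -/
def ip (f g : ℝ → ℝ) : ℝ :=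
  (∫ x, f x * g x ∂S.θ) +
    ∑ k : Fin S.m, ∑ i ∈ Finset.range (S.ord k + 1),
      S.M k i * derivI i f (S.a k) * derivI i g (S.a k)

/-- `q n` has degree `n` and positive leading coefficient, and the `q n` are orthonormal. -/
def IsOrthonormalSystem (q : ℕ → Polynomial ℝ) : Prop :=
  (∀ n, (q n).natDegree = n ∧ 0 < (q n).leadingCoeff) ∧
    ∀ n k, S.ip (fun x => (q n).eval x) (fun x => (q k).eval x) = if n = k then 1 else 0

/-- The class `R_p`: `∫ |f|^p dθ < ∞` and `f^{(i)}(a_k)` exists for `i ≤ N_k`. -/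
def MemR (p : ℝ) (f : ℝ → ℝ) : Prop :=
  MemLp f (ENNReal.ofReal p) S.θ ∧ ∀ k, ∀ i ≤ S.ord k, DerivExists f i (S.a k)

/-- Fourier coefficient `c_k(f) = ⟨f, q_k⟩`. -/
def coeff (q : ℕ → Polynomial ℝ) (f : ℝ → ℝ) (k : ℕ) : ℝ :=
  S.ip f (fun x => (q k).eval x)

/-- Partial sum, over `k < n`, of the multiplier series `∑ φ_k c_k(f) q_k(x)`. -/
def multSum (q : ℕ → Polynomial ℝ) (φ : ℕ → ℝ) (f : ℝ → ℝ) (n : ℕ) (x : ℝ) : ℝ :=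
  ∑ k ∈ Finset.range n, φ k * S.coeff q f k * (q k).eval x

/-- `N_k^*`: the least even integer greater than `N_k`. -/
def ordStar (k : Fin S.m) : ℕ :=
  if Odd (S.ord k) then S.ord k + 1 else S.ord k + 2

/-- `N = ∑ N_k^*`. -/
def N : ℕ := ∑ k, S.ordStar k

/-- `w_N(x) = ∏ (x - a_k)^{N_k^*}`. -/
def w (x : ℝ) : ℝ := ∏ k, (x - S.a k) ^ S.ordStar k

/-- `π_{N+1}(x) = ∫_{-1}^x w_N(t) dt`. -/
def primW (x : ℝ) : ℝ := ∫ t in (-1 : ℝ)..x, S.w t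

/-- The recurrence coefficients `d_{n,j}`: the coefficient of `q_{n-j}` in the expansion
`π_{N+1} q_n = ∑_{j=0}^{N+1} d_{n+j,j} q_{n+j} + ∑_{j=1}^{N+1} d_{n,j} q_{n-j}`,
with `d_{n,j} = 0` for `n < j`. -/
def recCoeff (q : ℕ → Polynomial ℝ) (n j : ℕ) : ℝ :=
  if j ≤ n then S.ip (fun x => S.primW x * (q n).eval x) (fun x => (q (n - j)).eval x) else 0

/-- The open set `ε_m = (-1, 1) \ {a_1, …, a_m}`. -/
def eps : Set ℝ := Ioo (-1 : ℝ) 1 \ range S.a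

end SobolevData

end

/-!
Multiplication by `π_{N+1}` is symmetric for `⟨·, ·⟩`, since the derivatives of `π_{N+1}` of orders
`1, …, N_k` vanish at `a_k`, and its matrix in the basis `q` is banded. Point evaluations and the
functionals `P ↦ P^{(i)}(a_k)` are eigenvectors of its transpose, so a summation by parts against
diagonals of bounded variation bounds the Dirichlet kernel `∑_{i < n} q_i(t) q_i(x)` by
`C h(t) h(x) / |π_{N+1}(t) - π_{N+1}(x)|`, and a second one bounds the Fejér kernel by the same
expression with the denominator squared. For `x` in a compact subset of `ε_m` the denominator is
comparable with `|t - x|` from below.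

At a Lebesgue point for the weight `h`, splitting the integrals over the intervals
`|t - x| ≤ 1 / (k + 1)` then shows that the partial sums of `∑ c_k(f) q_k(x)` are `o(ln n)` and that
their Cesàro means are bounded. Two Abel summations turn this into convergence of
`∑ φ_k c_k(f) q_k(x)`. The endpoints `±1`, where `h` says nothing about the `q_k`, are harmless:
either they are `θ`-null, or `∫ q_k² dθ ≤ 1` bounds the `q_k` there.
-/

section BoundedVariation

variable {g : ℤ → ℝ}

theorem summable_abs_add_sub (hg : Summable fun k => |g (k + 1) - g k|) (i : ℤ) :
    Summable fun k => |g (k + i) - g k| := by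
  have hshift : ∀ i : ℤ, Summable fun k => |g (k + i + 1) - g (k + i)| := fun i =>
    (Equiv.addRight i).summable_iff.mpr hg
  induction i using Int.induction_on with
  | zero => simp
  | succ i ih =>
    refine .of_nonneg_of_le (fun _ => abs_nonneg _) (fun k => ?_) ((hshift i).add ih)
    rw [← add_assoc]
    exact abs_sub_le _ _ _
  | pred i ih =>
    refine .of_nonneg_of_le (fun _ => abs_nonneg _) (fun k => ?_) ((hshift (-i - 1)).add ih)
    rw [abs_sub_comm (g (k + (-i - 1) + 1)), show k + -(i : ℤ) = k + (-i - 1) + 1 by ring]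
    exact abs_sub_le _ _ _

theorem abs_add_sub_le_tsum (hg : Summable fun k => |g (k + 1) - g k|) (k : ℤ) (n : ℕ) :
    |g (k + n) - g k| ≤ ∑' j, |g (j + 1) - g j| := by
  have hinj : Function.Injective fun i : ℕ => k + (i : ℤ) := fun a b hab => by simpa using hab
  have htel := Finset.sum_range_sub (fun i : ℕ => g (k + i)) n
  simp only [Nat.cast_add, Nat.cast_one, Nat.cast_zero, add_zero, ← add_assoc] at htel
  rw [← htel]
  calc |∑ i ∈ Finset.range n, (g (k + i + 1) - g (k + i))|
      ≤ ∑ i ∈ Finset.range n, |g (k + i + 1) - g (k + i)| := Finset.abs_sum_le_sum_abs _ _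
    _ ≤ ∑' i : ℕ, |g (k + i + 1) - g (k + i)| :=
        (hg.comp_injective hinj).sum_le_tsum _ fun _ _ => abs_nonneg _
    _ ≤ ∑' j, |g (j + 1) - g j| :=
        tsum_comp_le_tsum_of_inj hg (fun _ => abs_nonneg _) hinj

theorem exists_abs_le_of_summable_abs_sub (hg : Summable fun k => |g (k + 1) - g k|) :
    ∃ B, ∀ k, |g k| ≤ B := by
  refine ⟨|g 0| + ∑' j, |g (j + 1) - g j|, fun k => ?_⟩
  have hdist : |g k - g 0| ≤ ∑' j, |g (j + 1) - g j| := by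
    obtain ⟨n, rfl | rfl⟩ := Int.eq_nat_or_neg k
    · simpa using abs_add_sub_le_tsum hg 0 n
    · rw [abs_sub_comm]
      simpa using abs_add_sub_le_tsum hg (-n) n
  linarith [abs_sub_abs_le_abs_sub (g k) (g 0)]

theorem hasSum_ite_mem_Icc (n R : ℤ) (c : ℝ) :
    HasSum (fun k => if k ∈ Finset.Icc (n - R) (n + R) then c else 0) ((2 * R + 1).toNat * c) := by
  have hcard : (Finset.Icc (n - R) (n + R)).card = (2 * R + 1).toNat := by
    rw [Int.card_Icc]
    congr 1
    ring
  have hconst : ∑ k ∈ Finset.Icc (n - R) (n + R),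
      (if k ∈ Finset.Icc (n - R) (n + R) then c else 0) = (2 * R + 1).toNat * c := by
    rw [Finset.sum_congr rfl fun k hk => if_pos hk, Finset.sum_const, hcard, nsmul_eq_mul]
  rw [← hconst]
  exact hasSum_sum_of_ne_finset_zero fun k hk => if_neg hk

theorem exists_tsum_abs_commutator_le {a b : ℤ → ℝ} (ha : Summable fun k => |a (k + 1) - a k|)
    (hb : Summable fun k => |b (k + 1) - b k|) (i j R : ℤ) (D : ℝ) :
    ∃ C, ∀ (δ : ℤ → ℝ) (n : ℤ), (∀ k, |δ k| ≤ D) →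
      (∀ k ∉ Finset.Icc (n - R) (n + R), δ (k + i) = δ k) →
      (Summable fun k => |δ k * a k * b (k + j) - δ (k + i) * a (k + i) * b k|) ∧
      ∑' k, |δ k * a k * b (k + j) - δ (k + i) * a (k + i) * b k| ≤ C := by
  obtain ⟨A, hA⟩ := exists_abs_le_of_summable_abs_sub ha
  obtain ⟨B, hB⟩ := exists_abs_le_of_summable_abs_sub hb
  refine ⟨D * A * (∑' k, |b (k + j) - b k|) + D * B * (∑' k, |a (k + i) - a k|) +
    (2 * R + 1).toNat * (2 * D * (A * B)), fun δ n hδ hloc => ?_⟩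
  have hA0 : 0 ≤ A := (abs_nonneg _).trans (hA 0)
  have hD0 : 0 ≤ D := (abs_nonneg _).trans (hδ 0)
  set window : ℤ → ℝ := fun k => if k ∈ Finset.Icc (n - R) (n + R) then 2 * D * (A * B) else 0
  have hwindow : HasSum window ((2 * R + 1).toNat * (2 * D * (A * B))) := hasSum_ite_mem_Icc ..
  have hle : ∀ k, |δ k * a k * b (k + j) - δ (k + i) * a (k + i) * b k| ≤
      D * A * |b (k + j) - b k| + D * B * |a (k + i) - a k| + window k := fun k => by
    have hsplit : δ k * a k * b (k + j) - δ (k + i) * a (k + i) * b k =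
      δ k * a k * (b (k + j) - b k) + δ k * b k * (-(a (k + i) - a k)) +
        (δ k - δ (k + i)) * (a (k + i) * b k) := by ring
    rw [hsplit]
    refine (abs_add_three _ _ _).trans ?_
    simp only [abs_mul, abs_neg]
    gcongr
    · exact hδ k
    · exact hA k
    · exact hδ k
    · exact hB k
    · by_cases hk : k ∈ Finset.Icc (n - R) (n + R)
      · simp only [window, if_pos hk]
        have hdiff : |δ k - δ (k + i)| ≤ 2 * D :=
          (abs_sub _ _).trans (by linarith [hδ k, hδ (k + i)])
        gcongr
        exacts [hA _, hB k]
      · simp only [window, if_neg hk, hloc k hk, sub_self, abs_zero, zero_mul, le_refl]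
  have hsum := (((summable_abs_add_sub hb j).hasSum.mul_left (D * A)).add
    ((summable_abs_add_sub ha i).hasSum.mul_left (D * B))).add hwindow
  have hsummable := Summable.of_nonneg_of_le (fun _ => abs_nonneg _) hle hsum.summable
  exact ⟨hsummable, hasSum_le hle hsummable.hasSum hsum⟩

end BoundedVariation

theorem abs_tsum_mul_mul_le {γ u v : ℤ → ℝ} {C U V : ℝ} {i : ℤ} (hγ : Summable fun k => |γ k|)
    (hC : ∑' k, |γ k| ≤ C) (hu : ∀ k, |u k| ≤ U) (hv : ∀ k, |v k| ≤ V) :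
    |∑' k, γ k * u (k + i) * v k| ≤ C * U * V := by
  have hU : 0 ≤ U := (abs_nonneg _).trans (hu 0)
  have hV : 0 ≤ V := (abs_nonneg _).trans (hv 0)
  have hle : ∀ k, ‖γ k * u (k + i) * v k‖ ≤ |γ k| * (U * V) := fun k => by
    rw [Real.norm_eq_abs, abs_mul, abs_mul, mul_assoc]
    gcongr
    exacts [hu _, hv k]
  calc _ ≤ (∑' k, |γ k|) * (U * V) := tsum_of_norm_bounded (hγ.hasSum.mul_right (U * V)) hle
    _ ≤ C * (U * V) := by gcongr
    _ = C * U * V := by ring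

section BandedMatrix

/-- `u` is an eigenvector, with eigenvalue `z`, of the part of the bi-infinite matrix `A` within
distance `L` of the diagonal. -/
def IsBandEigenvector (A : ℤ → ℤ → ℝ) (L : ℤ) (z : ℝ) (u : ℤ → ℝ) : Prop :=
  ∀ k, z * u k = ∑ l ∈ Finset.Icc (-L) L, A k (k + l) * u (k + l)

variable {A : ℤ → ℤ → ℝ} {L : ℤ} {u v : ℤ → ℝ} {z y : ℝ}

theorem summable_of_eq_zero_of_notMem_Icc {g : ℤ → ℝ} (a b : ℤ)
    (h : ∀ k, k < a ∨ b < k → g k = 0) : Summable g :=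
  summable_of_ne_finset_zero (s := Finset.Icc a b) fun k hk => h k <| by
    rw [Finset.mem_Icc] at hk
    omega

theorem IsBandEigenvector.tsum_mul_mul_eq (hsymm : ∀ k m, A k m = A m k)
    (hv : IsBandEigenvector A L y v) (hv0 : ∀ k < 0, v k = 0) {β : ℤ → ℝ} {n : ℤ}
    (hβ : ∀ k, n ≤ k → β k = 0) (j : ℤ) :
    ∑' k, β k * u (k + j) * (y * v k) =
      ∑ l ∈ Finset.Icc (-L) L, ∑' k, β (k + l) * A k (k + l) * u (k + j + l) * v k := by
  have hsummable : ∀ l, Summable fun k => β k * A k (k + l) * u (k + j) * v (k + l) := fun l =>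
    summable_of_eq_zero_of_notMem_Icc (-l) n fun k hk => by
      rcases hk with hk | hk
      · rw [hv0 (k + l) (by omega), mul_zero]
      · simp [hβ k hk.le]
  calc ∑' k, β k * u (k + j) * (y * v k)
      = ∑' k, ∑ l ∈ Finset.Icc (-L) L, β k * A k (k + l) * u (k + j) * v (k + l) :=
        tsum_congr fun k => by
          rw [hv k, Finset.mul_sum]
          exact Finset.sum_congr rfl fun l _ => by ring
    _ = ∑ l ∈ Finset.Icc (-L) L, ∑' k, β k * A k (k + l) * u (k + j) * v (k + l) :=
        Summable.tsum_finsetSum fun l _ => hsummable l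
    _ = ∑ l ∈ Finset.Icc (-L) L, ∑' k, β k * A k (k - l) * u (k + j) * v (k - l) :=
        Finset.sum_nbij' (fun l => -l) (fun l => -l)
          (fun l hl => by rw [Finset.mem_Icc] at *; omega)
          (fun l hl => by rw [Finset.mem_Icc] at *; omega) (by simp) (by simp) (by simp)
    _ = ∑ l ∈ Finset.Icc (-L) L, ∑' k, β (k + l) * A k (k + l) * u (k + j + l) * v k :=
        Finset.sum_congr rfl fun l _ => by
          rw [← (Equiv.addRight l).tsum_eq]
          refine tsum_congr fun k => ?_
          simp only [Equiv.coe_addRight, add_sub_cancel_right, hsymm (k + l) k,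
            add_right_comm k l j]

-- The new weights are entries of a commutator: they are summable as soon as `β` and the diagonals
-- of `A` have bounded variation.
theorem IsBandEigenvector.sub_mul_tsum_eq (hsymm : ∀ k m, A k m = A m k)
    (hu : IsBandEigenvector A L z u) (hv : IsBandEigenvector A L y v) (hv0 : ∀ k < 0, v k = 0)
    {β : ℤ → ℝ} {n : ℤ} (hβ : ∀ k, n ≤ k → β k = 0) (j : ℤ) :
    (z - y) * ∑' k, β k * u (k + j) * v k =
      ∑ l ∈ Finset.Icc (-L) L,
        ∑' k, (β k * A (k + j) (k + j + l) - β (k + l) * A k (k + l)) * u (k + (j + l)) * v k := by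
  have hleft : ∀ w : ℤ → ℝ, Summable fun k => β k * w k * v k := fun w =>
    summable_of_eq_zero_of_notMem_Icc 0 n fun k hk => by
      rcases hk with hk | hk
      · rw [hv0 k hk, mul_zero]
      · simp [hβ k hk.le]
  have hright : ∀ (l : ℤ) (w : ℤ → ℝ), Summable fun k => β (k + l) * A k (k + l) * w k * v k :=
    fun l w => summable_of_eq_zero_of_notMem_Icc 0 (n - l) fun k hk => by
      rcases hk with hk | hk
      · rw [hv0 k hk, mul_zero]
      · simp [hβ (k + l) (by omega)]
  have hz : z * ∑' k, β k * u (k + j) * v k = ∑ l ∈ Finset.Icc (-L) L,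
      ∑' k, β k * (A (k + j) (k + j + l) * u (k + j + l)) * v k := by
    rw [← tsum_mul_left, ← Summable.tsum_finsetSum fun l _ => hleft _]
    refine tsum_congr fun k => ?_
    rw [← Finset.sum_mul, ← Finset.mul_sum, ← hu (k + j)]
    ring
  have hy : y * ∑' k, β k * u (k + j) * v k = ∑ l ∈ Finset.Icc (-L) L,
      ∑' k, β (k + l) * A k (k + l) * u (k + j + l) * v k := by
    rw [← hv.tsum_mul_mul_eq hsymm hv0 hβ, ← tsum_mul_left]
    exact tsum_congr fun k => by ring
  rw [sub_mul, hz, hy, ← Finset.sum_sub_distrib]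
  refine Finset.sum_congr rfl fun l _ => ?_
  rw [← (hleft _).tsum_sub (hright l _)]
  exact tsum_congr fun k => by rw [add_assoc k j l]; ring

variable (hsymm : ∀ k m, A k m = A m k)
  (hBV : ∀ l, Summable fun k => |A (k + 1) (k + 1 + l) - A k (k + l)|)
include hsymm hBV

theorem exists_dirichletKernel_bound (L : ℤ) :
    ∃ C, ∀ (n : ℤ) (u v : ℤ → ℝ) (z y U V : ℝ), (∀ k < 0, v k = 0) →
      IsBandEigenvector A L z u → IsBandEigenvector A L y v →
      (∀ k, |u k| ≤ U) → (∀ k, |v k| ≤ V) →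
      |(z - y) * ∑' k, (if k < n then 1 else 0) * u k * v k| ≤ C * U * V := by
  choose C hC using fun l => exists_tsum_abs_commutator_le (a := fun _ => 1)
    (b := fun k => A k (k + l)) (by simp) (hBV l) l 0 L 1
  refine ⟨∑ l ∈ Finset.Icc (-L) L, C l, fun n u v z y U V hv0 hu hv hU hV => ?_⟩
  have habel := hu.sub_mul_tsum_eq hsymm hv hv0 (β := fun k => if k < n then 1 else 0) (n := n)
    (fun k hk => if_neg (by omega)) 0
  simp only [add_zero, zero_add] at habel
  rw [habel, Finset.sum_mul, Finset.sum_mul]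
  refine (Finset.abs_sum_le_sum_abs _ _).trans (Finset.sum_le_sum fun l hl => ?_)
  rw [Finset.mem_Icc] at hl
  obtain ⟨hsummable, htsum⟩ := hC l (fun k => if k < n then 1 else 0) n
    (fun k => by split_ifs <;> simp) (fun k hk => by
      rw [Finset.mem_Icc] at hk
      exact if_congr (by omega) rfl rfl)
  simp only [mul_one, add_zero] at hsummable htsum
  exact abs_tsum_mul_mul_le hsummable htsum hU hV

theorem exists_fejerKernel_bound (L : ℤ) :
    ∃ C, ∀ (n : ℤ) (u v : ℤ → ℝ) (z y U V : ℝ), (∀ k < 0, v k = 0) →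
      IsBandEigenvector A L z u → IsBandEigenvector A L y v →
      (∀ k, |u k| ≤ U) → (∀ k, |v k| ≤ V) →
      |(z - y) ^ 2 * ∑' k, ((max (n - k) 0 : ℤ) : ℝ) * u k * v k| ≤ C * U * V := by
  choose C hC using fun j l => exists_tsum_abs_commutator_le (a := fun k => A k (k + j))
    (b := fun k => A k (k + l)) (hBV j) (hBV l) l j (2 * L) L
  refine ⟨∑ j ∈ Finset.Icc (-L) L, ∑ l ∈ Finset.Icc (-L) L, C j l,
    fun n u v z y U V hv0 hu hv hU hV => ?_⟩
  set ψ : ℤ → ℝ := fun k => ((max (n - k) 0 : ℤ) : ℝ) with hψ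
  have hψ0 : ∀ k, n ≤ k → ψ k = 0 := fun k hk => by
    simp only [hψ]
    rw [max_eq_right (by omega), Int.cast_zero]
  have habel := hu.sub_mul_tsum_eq hsymm hv hv0 hψ0 0
  simp only [add_zero, zero_add, ← sub_mul] at habel
  rw [pow_two, mul_assoc, habel, Finset.mul_sum, Finset.sum_mul, Finset.sum_mul]
  refine (Finset.abs_sum_le_sum_abs _ _).trans (Finset.sum_le_sum fun j hj => ?_)
  rw [Finset.mem_Icc] at hj
  rw [hu.sub_mul_tsum_eq hsymm hv hv0 (β := fun k => (ψ k - ψ (k + j)) * A k (k + j))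
    (n := n + L) (fun k hk => by rw [hψ0 k (by omega), hψ0 (k + j) (by omega)]; ring) j,
    Finset.sum_mul, Finset.sum_mul]
  refine (Finset.abs_sum_le_sum_abs _ _).trans (Finset.sum_le_sum fun l hl => ?_)
  rw [Finset.mem_Icc] at hl
  obtain ⟨hsummable, htsum⟩ := hC j l (fun k => ψ k - ψ (k + j)) n
    (fun k => by
      simp only [hψ]
      rw [← Int.cast_sub, ← Int.cast_abs, Int.cast_le, abs_le]
      omega)
    (fun k hk => by
      rw [Finset.mem_Icc] at hk
      simp only [hψ]
      rw [← Int.cast_sub, ← Int.cast_sub, Int.cast_inj]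
      omega)
  exact abs_tsum_mul_mul_le hsummable htsum hU hV

end BandedMatrix

section Extension

/-- Extension by zero of a sequence indexed by the natural numbers to the integers, which removes
the boundary terms from summations by parts. -/
def extendInt (u : ℕ → ℝ) (k : ℤ) : ℝ := if 0 ≤ k then u k.toNat else 0

/-- Extension by zero of a matrix indexed by the natural numbers to the integers. -/
def extendIntMatrix (A : ℕ → ℕ → ℝ) (k m : ℤ) : ℝ :=
  if 0 ≤ k ∧ 0 ≤ m then A k.toNat m.toNat else 0

/-- `u` solves, with spectral parameter `z`, the recurrence `z u n = ∑ m, A n m u m` of a matrix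
with `A n m = 0` for `m > n + L`. -/
def IsRecurrenceSolution (A : ℕ → ℕ → ℝ) (L : ℕ) (z : ℝ) (u : ℕ → ℝ) : Prop :=
  ∀ n, z * u n = ∑ m ∈ Finset.range (n + L + 1), A n m * u m

variable {A : ℕ → ℕ → ℝ} {L : ℕ} {u v : ℕ → ℝ} {z : ℝ}

theorem extendInt_natCast (u : ℕ → ℝ) (n : ℕ) : extendInt u n = u n := by simp [extendInt]

theorem extendInt_of_neg (u : ℕ → ℝ) {k : ℤ} (hk : k < 0) : extendInt u k = 0 :=
  if_neg (by omega)

theorem abs_extendInt_le {U : ℝ} (hu : ∀ n, |u n| ≤ U) (k : ℤ) : |extendInt u k| ≤ U := by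
  unfold extendInt
  split_ifs
  · exact hu _
  · simpa using (abs_nonneg _).trans (hu 0)

theorem tsum_mul_extendInt_mul_extendInt {β : ℤ → ℝ} {n : ℕ} (hβ : ∀ k : ℤ, n ≤ k → β k = 0)
    (u v : ℕ → ℝ) :
    ∑' k, β k * extendInt u k * extendInt v k = ∑ i ∈ Finset.range n, β i * (u i * v i) := by
  rw [tsum_eq_sum (s := (Finset.range n).map Nat.castEmbedding), Finset.sum_map]
  · exact Finset.sum_congr rfl fun i _ => by simp [extendInt, mul_assoc]
  · intro k hk
    rcases lt_or_ge k 0 with hneg | hnonneg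
    · rw [extendInt_of_neg v hneg, mul_zero]
    · lift k to ℕ using hnonneg
      have hnk : n ≤ k := by
        by_contra hlt
        exact hk (Finset.mem_map.mpr ⟨k, Finset.mem_range.mpr (by omega), by simp⟩)
      rw [hβ k (by omega), zero_mul, zero_mul]

theorem extendIntMatrix_comm (hsymm : ∀ n m, A n m = A m n) (k m : ℤ) :
    extendIntMatrix A k m = extendIntMatrix A m k := by
  unfold extendIntMatrix
  rw [hsymm]
  simp only [and_comm]

theorem IsRecurrenceSolution.isBandEigenvector_extendInt (hband : ∀ n m, m + L < n → A n m = 0)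
    (hu : IsRecurrenceSolution A L z u) :
    IsBandEigenvector (extendIntMatrix A) L z (extendInt u) := by
  intro k
  rcases lt_or_ge k 0 with hneg | hnonneg
  · rw [extendInt_of_neg u hneg, mul_zero]
    exact (Finset.sum_eq_zero fun l _ => by simp [extendIntMatrix, hneg.not_ge]).symm
  lift k to ℕ using hnonneg
  rw [extendInt_natCast, hu]
  have hleft : ∀ m ∈ Finset.range (k + L + 1), A k m * u m ≠ 0 → k ≤ m + L := fun m _ hne => by
    by_contra hlt
    exact hne (by rw [hband k m (by omega), zero_mul])
  have hright : ∀ l ∈ Finset.Icc (-(L : ℤ)) L,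
      extendIntMatrix A k (k + l) * extendInt u (k + l) ≠ 0 → 0 ≤ (k : ℤ) + l := fun l _ hne => by
    by_contra hlt
    exact hne (by rw [extendInt_of_neg u (by omega), mul_zero])
  rw [← Finset.sum_filter_of_ne hleft, ← Finset.sum_filter_of_ne hright]
  refine Finset.sum_nbij' (fun m => (m : ℤ) - k) (fun l => ((k : ℤ) + l).toNat) ?_ ?_ ?_ ?_ ?_
  · intro m hm
    simp only [Finset.mem_filter, Finset.mem_range, Finset.mem_Icc] at hm ⊢
    omega
  · intro l hl
    simp only [Finset.mem_filter, Finset.mem_range, Finset.mem_Icc] at hl ⊢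
    omega
  · intro m _
    omega
  · intro l hl
    rw [Finset.mem_filter] at hl
    omega
  · intro m _
    simp [extendIntMatrix, extendInt]

theorem summable_abs_extendIntMatrix_sub (hsymm : ∀ n m, A n m = A m n)
    (hBV : ∀ l, Summable fun s => |A s (s + l) - A (s + 1) (s + 1 + l)|) (l : ℤ) :
    Summable fun k =>
      |extendIntMatrix A (k + 1) (k + 1 + l) - extendIntMatrix A k (k + l)| := by
  have hupper : ∀ l : ℕ, Summable fun k =>
      |extendIntMatrix A (k + 1) (k + 1 + l) - extendIntMatrix A k (k + l)| := fun l => by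
    have hnat : ∀ n : ℕ, extendIntMatrix A n (n + l) = A n (n + l) := fun n => if_pos (by omega)
    refine .of_nat_of_neg ((hBV l).congr fun s => ?_) ?_
    · have hsucc := hnat (s + 1)
      push_cast at hsucc
      rw [hsucc, hnat, abs_sub_comm]
    · refine summable_of_ne_finset_zero (s := Finset.range 2) fun s hs => ?_
      rw [Finset.mem_range] at hs
      simp only [extendIntMatrix]
      rw [if_neg (by omega), if_neg (by omega), sub_self, abs_zero]
  obtain ⟨n, rfl | rfl⟩ := Int.eq_nat_or_neg l
  · exact hupper n
  · refine ((Equiv.addRight (-(n : ℤ))).summable_iff.mpr (hupper n)).congr fun k => ?_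
    simp only [Function.comp, Equiv.coe_addRight]
    rw [extendIntMatrix_comm hsymm (k + 1), extendIntMatrix_comm hsymm k]
    congr 3 <;> ring

end Extension

section CesaroSum

/-- The unnormalized Cesàro sums of order `s ∈ {0, 1}` of a series: the partial sums, for `s = 0`,
and the sums of the partial sums, for `s = 1`. -/
def cesaroSum (s : ℕ) (a : ℕ → ℝ) (n : ℕ) : ℝ :=
  ∑ i ∈ Finset.range n, ((n : ℝ) - i) ^ s * a i

/-- `C` is a constant in the Dirichlet (`s = 0`) and Fejér (`s = 1`) kernel estimates for the
bounded solutions of the recurrence of `A`. -/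
def HasKernelBound (A : ℕ → ℕ → ℝ) (L : ℕ) (C : ℝ) : Prop :=
  ∀ s < 2, ∀ (n : ℕ) (u v : ℕ → ℝ) (z y U V : ℝ),
    IsRecurrenceSolution A L z u → IsRecurrenceSolution A L y v →
    (∀ k, |u k| ≤ U) → (∀ k, |v k| ≤ V) →
    |z - y| ^ (s + 1) * |cesaroSum s (fun i => u i * v i) n| ≤ C * U * V

theorem exists_hasKernelBound {A : ℕ → ℕ → ℝ} {L : ℕ} (hsymm : ∀ n m, A n m = A m n)
    (hband : ∀ n m, m + L < n → A n m = 0)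
    (hBV : ∀ l, Summable fun s => |A s (s + l) - A (s + 1) (s + 1 + l)|) :
    ∃ C, 1 ≤ C ∧ HasKernelBound A L C := by
  have hsymm' := extendIntMatrix_comm hsymm
  have hBV' := summable_abs_extendIntMatrix_sub hsymm hBV
  obtain ⟨C₀, hC₀⟩ := exists_dirichletKernel_bound hsymm' hBV' L
  obtain ⟨C₁, hC₁⟩ := exists_fejerKernel_bound hsymm' hBV' L
  refine ⟨max 1 (max C₀ C₁), le_max_left _ _, fun s hs n u v z y U V hu hv hU hV => ?_⟩
  have hU0 : 0 ≤ U := (abs_nonneg _).trans (hU 0)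
  have hV0 : 0 ≤ V := (abs_nonneg _).trans (hV 0)
  have hu' := hu.isBandEigenvector_extendInt hband
  have hv' := hv.isBandEigenvector_extendInt hband
  have hv0 : ∀ k < 0, extendInt v k = 0 := fun k hk => extendInt_of_neg v hk
  rw [← abs_pow, ← abs_mul]
  obtain rfl | rfl : s = 0 ∨ s = 1 := by omega
  · calc |(z - y) ^ (0 + 1) * cesaroSum 0 (fun i => u i * v i) n| ≤ C₀ * U * V := by
          have hbound := hC₀ n _ _ z y U V hv0 hu' hv' (abs_extendInt_le hU) (abs_extendInt_le hV)
          rw [tsum_mul_extendInt_mul_extendInt (n := n) (fun k hk => if_neg (by omega))] at hbound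
          convert hbound using 3
          · ring
          · refine Finset.sum_congr rfl fun i hi => ?_
            rw [pow_zero, if_pos (by simpa using hi)]
      _ ≤ max 1 (max C₀ C₁) * U * V := by gcongr; simp
  · calc |(z - y) ^ (1 + 1) * cesaroSum 1 (fun i => u i * v i) n| ≤ C₁ * U * V := by
          have hbound := hC₁ n _ _ z y U V hv0 hu' hv' (abs_extendInt_le hU) (abs_extendInt_le hV)
          rw [tsum_mul_extendInt_mul_extendInt (n := n)
            fun k hk => by rw [max_eq_right (by omega), Int.cast_zero]] at hbound
          convert hbound using 3
          refine Finset.sum_congr rfl fun i hi => ?_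
          rw [Finset.mem_range] at hi
          rw [pow_one, max_eq_left (by omega)]
          push_cast
          rfl
      _ ≤ max 1 (max C₀ C₁) * U * V := by gcongr; simp

theorem abs_cesaroSum_le_pow_mul {a : ℕ → ℝ} {B : ℝ} (ha : ∀ i, |a i| ≤ B) (s n : ℕ) :
    |cesaroSum s a n| ≤ (n : ℝ) ^ (s + 1) * B := by
  have hterm : ∀ i ∈ Finset.range n, |((n : ℝ) - i) ^ s * a i| ≤ (n : ℝ) ^ s * B := fun i hi => by
    have hin : (i : ℝ) ≤ n := by exact_mod_cast (Finset.mem_range.mp hi).le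
    rw [abs_mul, abs_pow, abs_of_nonneg (sub_nonneg.mpr hin)]
    gcongr
    · exact sub_le_self _ i.cast_nonneg
    · exact ha i
  calc |cesaroSum s a n| ≤ ∑ i ∈ Finset.range n, |((n : ℝ) - i) ^ s * a i| :=
        Finset.abs_sum_le_sum_abs _ _
    _ ≤ ∑ _i ∈ Finset.range n, (n : ℝ) ^ s * B := Finset.sum_le_sum hterm
    _ = (n : ℝ) ^ (s + 1) * B := by
        rw [Finset.sum_const, Finset.card_range, nsmul_eq_mul]
        ring

theorem exists_le_forall_lt_le_one_div (n : ℕ) (y : ℝ) :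
    ∃ m ≤ n, (∀ k < m, y ≤ 1 / ((k : ℝ) + 1)) ∧ (m = n ∨ 1 ≤ ((m : ℝ) + 1) * y) := by
  induction n with
  | zero => exact ⟨0, le_rfl, by simp, Or.inl rfl⟩
  | succ n ih =>
    obtain ⟨m, hm, hbelow, rfl | habove⟩ := ih
    · by_cases hy : y ≤ 1 / ((m : ℝ) + 1)
      · refine ⟨m + 1, le_rfl, fun k hk => ?_, Or.inl rfl⟩
        rcases Nat.lt_succ_iff_lt_or_eq.mp hk with hk | rfl
        exacts [hbelow k hk, hy]
      · refine ⟨m, by omega, hbelow, Or.inr ?_⟩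
        rw [not_le, div_lt_iff₀ (by positivity)] at hy
        linarith
    · exact ⟨m, by omega, hbelow, Or.inr habove⟩

-- The increments telescope to `min (n + 1) (1 / y) ^ t`, up to a constant; writing them as a
-- step function of `y` turns integrals of kernels into sums of averages over shrinking intervals.
theorem le_mul_one_add_sum_ite {n t : ℕ} {y D C H : ℝ} (hC : 1 ≤ C) (hH : 0 ≤ H) (hD : 0 ≤ D)
    (htrivial : D ≤ (n : ℝ) ^ t * H) (hdecay : y ^ t * D ≤ C * H) :
    D ≤ C * H * (1 + ∑ k ∈ Finset.range n,
      if y ≤ 1 / ((k : ℝ) + 1) then ((k : ℝ) + 2) ^ t - ((k : ℝ) + 1) ^ t else 0) := by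
  obtain ⟨m, hmn, hbelow, hor⟩ := exists_le_forall_lt_le_one_div n y
  have hincr : ∀ k : ℕ, 0 ≤ ((k : ℝ) + 2) ^ t - ((k : ℝ) + 1) ^ t := fun k =>
    sub_nonneg.mpr (by gcongr; norm_num)
  have hmain : D ≤ C * H * ((m : ℝ) + 1) ^ t := by
    rcases hor with rfl | habove
    · calc D ≤ (m : ℝ) ^ t * H := htrivial
        _ ≤ ((m : ℝ) + 1) ^ t * (C * H) := by
            gcongr
            · linarith
            · exact le_mul_of_one_le_left hH hC
        _ = C * H * ((m : ℝ) + 1) ^ t := mul_comm _ _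
    · calc D ≤ (((m : ℝ) + 1) * y) ^ t * D := le_mul_of_one_le_left hD (one_le_pow₀ habove)
        _ = ((m : ℝ) + 1) ^ t * (y ^ t * D) := by rw [mul_pow, mul_assoc]
        _ ≤ ((m : ℝ) + 1) ^ t * (C * H) := by gcongr
        _ = C * H * ((m : ℝ) + 1) ^ t := mul_comm _ _
  have htelescope : ∑ k ∈ Finset.range m, (((k : ℝ) + 2) ^ t - ((k : ℝ) + 1) ^ t) =
      ((m : ℝ) + 1) ^ t - 1 := by
    have := Finset.sum_range_sub (fun k : ℕ => ((k : ℝ) + 1) ^ t) m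
    push_cast at this
    simpa [add_assoc, one_add_one_eq_two] using this
  have hsteps : ((m : ℝ) + 1) ^ t - 1 ≤ ∑ k ∈ Finset.range n,
      if y ≤ 1 / ((k : ℝ) + 1) then ((k : ℝ) + 2) ^ t - ((k : ℝ) + 1) ^ t else 0 := by
    rw [← htelescope, ← Finset.sum_congr rfl fun k hk =>
      if_pos (hbelow k (Finset.mem_range.mp hk))]
    exact Finset.sum_le_sum_of_subset_of_nonneg (Finset.range_subset_range.mpr hmn)
      fun k _ _ => by split_ifs; exacts [hincr k, le_rfl]
  calc D ≤ C * H * ((m : ℝ) + 1) ^ t := hmain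
    _ ≤ _ := by gcongr; linarith

theorem HasKernelBound.abs_cesaroSum_le {A : ℕ → ℕ → ℝ} {L : ℕ} {C : ℝ}
    (hC : HasKernelBound A L C) (hC1 : 1 ≤ C) {s : ℕ} (hs : s < 2) {u v : ℕ → ℝ} {z y U V : ℝ}
    (hu : IsRecurrenceSolution A L z u) (hv : IsRecurrenceSolution A L y v)
    (hU : ∀ k, |u k| ≤ U) (hV : ∀ k, |v k| ≤ V) {r κ : ℝ} (hr : 0 ≤ r) (hκ : 1 ≤ κ)
    (hrκ : r ≤ κ * |z - y|) (n : ℕ) :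
    |cesaroSum s (fun i => u i * v i) n| ≤ κ ^ (s + 1) * C * (U * V) *
      (1 + ∑ k ∈ Finset.range n,
        if r ≤ 1 / ((k : ℝ) + 1) then ((k : ℝ) + 2) ^ (s + 1) - ((k : ℝ) + 1) ^ (s + 1)
        else 0) := by
  have hU0 : 0 ≤ U := (abs_nonneg _).trans (hU 0)
  have hV0 : 0 ≤ V := (abs_nonneg _).trans (hV 0)
  refine le_mul_one_add_sum_ite (one_le_mul_of_one_le_of_one_le (one_le_pow₀ hκ) hC1)
    (mul_nonneg hU0 hV0) (abs_nonneg _) (abs_cesaroSum_le_pow_mul (fun i => ?_) s n) ?_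
  · rw [abs_mul]
    gcongr
    exacts [hU i, hV i]
  · calc r ^ (s + 1) * |cesaroSum s (fun i => u i * v i) n|
        ≤ (κ * |z - y|) ^ (s + 1) * |cesaroSum s (fun i => u i * v i) n| := by gcongr
      _ = κ ^ (s + 1) * (|z - y| ^ (s + 1) * |cesaroSum s (fun i => u i * v i) n|) := by
          rw [mul_pow, mul_assoc]
      _ ≤ κ ^ (s + 1) * (C * U * V) :=
          mul_le_mul_of_nonneg_left (hC s hs n u v z y U V hu hv hU hV) (by positivity)
      _ = κ ^ (s + 1) * C * (U * V) := by ring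

end CesaroSum

section Summation

theorem cesaroSum_zero_eq_sum (a : ℕ → ℝ) (n : ℕ) :
    cesaroSum 0 a n = ∑ i ∈ Finset.range n, a i := by
  simp [cesaroSum]

theorem cesaroSum_one_succ (a : ℕ → ℝ) (n : ℕ) :
    cesaroSum 1 a (n + 1) = cesaroSum 1 a n + cesaroSum 0 a (n + 1) := by
  rw [cesaroSum_zero_eq_sum, Finset.sum_range_succ a, cesaroSum, Finset.sum_range_succ, cesaroSum,
    ← add_assoc, ← Finset.sum_add_distrib]
  congr 1
  · exact Finset.sum_congr rfl fun i _ => by push_cast; ring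
  · push_cast
    ring

theorem sum_range_mul_eq_second_difference (φ a : ℕ → ℝ) (n : ℕ) :
    ∑ k ∈ Finset.range n, φ k * a k =
      φ n * cesaroSum 0 a n + (φ n - φ (n + 1)) * cesaroSum 1 a n +
      ∑ k ∈ Finset.range n, (φ k - 2 * φ (k + 1) + φ (k + 2)) * cesaroSum 1 a (k + 1) := by
  induction n with
  | zero => simp [cesaroSum]
  | succ n ih =>
    rw [Finset.sum_range_succ, ih, Finset.sum_range_succ _ n, cesaroSum_one_succ,
      cesaroSum_zero_eq_sum, cesaroSum_zero_eq_sum, Finset.sum_range_succ a]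
    ring

theorem tendsto_nat_mul_sub_succ_of_summable {φ : ℕ → ℝ}
    (hφ : Summable fun k : ℕ => ((k : ℝ) + 1) * |φ k - 2 * φ (k + 1) + φ (k + 2)|)
    (h0 : Tendsto φ atTop (𝓝 0)) :
    Tendsto (fun n : ℕ => (n : ℝ) * |φ n - φ (n + 1)|) atTop (𝓝 0) := by
  have hsecond : Summable fun k => |φ k - 2 * φ (k + 1) + φ (k + 2)| :=
    .of_nonneg_of_le (fun _ => abs_nonneg _)
      (fun k => le_mul_of_one_le_left (abs_nonneg _) (by simp)) hφ
  have hdiff : Tendsto (fun n => φ n - φ (n + 1)) atTop (𝓝 0) := by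
    simpa using h0.sub ((tendsto_add_atTop_iff_nat 1).mpr h0)
  have htail : ∀ n, |φ n - φ (n + 1)| ≤
      ∑' m, |φ (n + m) - 2 * φ (n + m + 1) + φ (n + m + 2)| := fun n => by
    have := dist_le_tsum_of_dist_le_of_tendsto _ (fun n => (?_ : _ ≤ _)) hsecond hdiff n
    · simpa [Real.dist_eq] using this
    · rw [Real.dist_eq]
      exact le_of_eq (congrArg _ (by simp only [Nat.succ_eq_add_one, add_assoc]; ring))
  refine squeeze_zero (fun n => by positivity) (fun n => ?_) (tendsto_sum_nat_add
    fun k : ℕ => ((k : ℝ) + 1) * |φ k - 2 * φ (k + 1) + φ (k + 2)|)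
  · calc (n : ℝ) * |φ n - φ (n + 1)|
        ≤ n * ∑' m, |φ (n + m) - 2 * φ (n + m + 1) + φ (n + m + 2)| := by
          gcongr
          exact htail n
      _ = ∑' m, n * |φ (m + n) - 2 * φ (m + n + 1) + φ (m + n + 2)| := by
          simp only [← tsum_mul_left, add_comm n]
      _ ≤ ∑' m, (((m + n : ℕ) : ℝ) + 1) * |φ (m + n) - 2 * φ (m + n + 1) + φ (m + n + 2)| := by
          refine Summable.tsum_le_tsum (fun m => ?_)
            (((summable_nat_add_iff n).mpr hsecond).mul_left _) ((summable_nat_add_iff n).mpr hφ)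
          gcongr
          push_cast
          linarith [(m.cast_nonneg : (0 : ℝ) ≤ m)]

theorem tendstoUniformlyOn_zero_of_abs_le {α : Type*} {K : Set α} {F : ℕ → α → ℝ} {b : ℕ → ℝ}
    (hF : ∀ n, ∀ x ∈ K, |F n x| ≤ b n) (hb : Tendsto b atTop (𝓝 0)) :
    TendstoUniformlyOn F 0 atTop K := by
  rw [Metric.tendstoUniformlyOn_iff]
  intro ε hε
  filter_upwards [hb.eventually (gt_mem_nhds hε)] with n hn x hx
  rw [Pi.zero_apply, dist_zero_left, Real.norm_eq_abs]
  exact (hF n x hx).trans_lt hn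

variable {α : Type*} {K : Set α} {a : ℕ → α → ℝ} {φ : ℕ → ℝ}
  (hφ : Summable fun k : ℕ => ((k : ℝ) + 1) * |φ k - 2 * φ (k + 1) + φ (k + 2)|)
  (hlog : φ =O[atTop] fun k : ℕ => 1 / Real.log (k : ℝ))
include hφ hlog

theorem tendstoUniformlyOn_sum_mul_of_cesaroSum_le {β : ℕ → ℝ} {C : ℝ}
    (hβ : β =o[atTop] fun n : ℕ => Real.log n)
    (hzero : ∀ n, ∀ x ∈ K, |cesaroSum 0 (a · x) n| ≤ β n)
    (hone : ∀ n, ∀ x ∈ K, |cesaroSum 1 (a · x) n| ≤ C * n) :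
    TendstoUniformlyOn (fun n x => ∑ k ∈ Finset.range n, φ k * a k x)
      (fun x => ∑' k, (φ k - 2 * φ (k + 1) + φ (k + 2)) * cesaroSum 1 (a · x) (k + 1))
      atTop K := by
  have hlog_atTop : Tendsto (fun n : ℕ => Real.log (n : ℝ)) atTop atTop :=
    Real.tendsto_log_atTop.comp tendsto_natCast_atTop_atTop
  have hφ0 : Tendsto φ atTop (𝓝 0) := hlog.trans_tendsto <| by
    simp only [one_div]
    exact hlog_atTop.inv_tendsto_atTop
  have hφβ : Tendsto (fun n => |φ n| * β n) atTop (𝓝 0) := by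
    have hcancel : (fun n : ℕ => 1 / Real.log (n : ℝ) * Real.log n) =ᶠ[atTop] fun _ => (1 : ℝ) := by
      filter_upwards [hlog_atTop.eventually_gt_atTop 0] with n hn
      exact one_div_mul_cancel hn.ne'
    exact ((hlog.abs_left.mul_isLittleO hβ).trans_eventuallyEq hcancel).tendsto_zero_of_tendsto
      tendsto_const_nhds
  have hsum := tendstoUniformlyOn_tsum_nat (s := K)
    (f := fun k x => (φ k - 2 * φ (k + 1) + φ (k + 2)) * cesaroSum 1 (a · x) (k + 1))
    (hφ.mul_left C) (fun k x hx => by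
      rw [norm_mul, Real.norm_eq_abs, Real.norm_eq_abs, mul_comm, ← mul_assoc]
      gcongr
      exact_mod_cast hone (k + 1) x hx)
  have hfirst : TendstoUniformlyOn (fun n x => φ n * cesaroSum 0 (a · x) n) 0 atTop K :=
    tendstoUniformlyOn_zero_of_abs_le (fun n x hx => by
      rw [abs_mul]
      gcongr
      exact hzero n x hx) hφβ
  have hsecond : TendstoUniformlyOn (fun n x => (φ n - φ (n + 1)) * cesaroSum 1 (a · x) n) 0
      atTop K :=
    tendstoUniformlyOn_zero_of_abs_le (fun n x hx => by
      rw [abs_mul]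
      calc _ ≤ |φ n - φ (n + 1)| * (C * n) := by
            gcongr
            exact hone n x hx
        _ = C * (n * |φ n - φ (n + 1)|) := by ring)
      (by simpa using (tendsto_nat_mul_sub_succ_of_summable hφ hφ0).const_mul C)
  have := (hfirst.add hsecond).add hsum
  simpa only [sum_range_mul_eq_second_difference φ, zero_add] using! this

end Summation

section Averages

theorem isLittleO_log_sum_range_of_isLittleO_one_div {b : ℕ → ℝ}
    (hb : b =o[atTop] fun k : ℕ => 1 / ((k : ℝ) + 1)) :
    (fun n => ∑ k ∈ Finset.range n, b k) =o[atTop] fun n : ℕ => Real.log n := by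
  refine (hb.sum_range (fun _ => by positivity)
    Real.tendsto_sum_range_one_div_nat_succ_atTop).trans_isBigO ?_
  refine IsBigO.of_bound 2 ?_
  filter_upwards [(Real.tendsto_log_atTop.comp tendsto_natCast_atTop_atTop).eventually_ge_atTop 1]
    with n hn
  have hharmonic := harmonic_le_one_add_log n
  simp only [harmonic, Rat.cast_sum, Nat.cast_add, Nat.cast_one, ← one_div] at hharmonic
  simp only [Function.comp_apply] at hn
  rw [Real.norm_of_nonneg (Finset.sum_nonneg fun _ _ => by positivity),
    Real.norm_of_nonneg (by linarith)]
  push_cast at hharmonic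
  linarith

theorem exists_sum_range_sq_sub_mul_le {b : ℕ → ℝ}
    (hb : b =o[atTop] fun k : ℕ => 1 / ((k : ℝ) + 1)) :
    ∃ C : ℝ, ∀ n : ℕ,
      ∑ k ∈ Finset.range n, (((k : ℝ) + 2) ^ 2 - ((k : ℝ) + 1) ^ 2) * b k ≤ C * n := by
  obtain ⟨M, hM⟩ := (isBigO_nat_atTop_iff fun k hk =>
    absurd hk (one_div_pos.mpr k.cast_add_one_pos).ne').mp hb.isBigO
  refine ⟨3 * M, fun n => ?_⟩
  rw [mul_comm, ← nsmul_eq_mul]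
  nth_rewrite 2 [← Finset.card_range n]
  refine Finset.sum_le_card_nsmul _ _ _ fun k _ => ?_
  have hk : (0 : ℝ) < k + 1 := k.cast_add_one_pos
  have hbk : b k * (k + 1) ≤ M := by
    have := (Real.le_norm_self _).trans (hM k)
    rwa [Real.norm_of_nonneg (one_div_pos.mpr hk).le, mul_one_div, le_div_iff₀ hk] at this
  have hM0 : 0 ≤ M := by simpa using (norm_nonneg _).trans (hM 0)
  calc (((k : ℝ) + 2) ^ 2 - ((k : ℝ) + 1) ^ 2) * b k
      = (2 + 1 / (k + 1)) * (b k * (k + 1)) := by field_simp; ring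
    _ ≤ (2 + 1 / (k + 1)) * M := by gcongr
    _ ≤ 3 * M := by
      gcongr
      linarith [(div_le_one hk).mpr (by linarith [k.cast_nonneg (α := ℝ)] : (1 : ℝ) ≤ k + 1)]

theorem exists_isLittleO_one_div_of_tendstoUniformlyOn {α : Type*} {K : Set α} {G : ℕ → α → ℝ}
    {B : ℝ} (hB : ∀ k, ∀ x ∈ K, |G k x| ≤ B)
    (hG : TendstoUniformlyOn (fun (k : ℕ) x => ((k : ℝ) + 1) * G k x) 0 atTop K) :
    ∃ b : ℕ → ℝ, (b =o[atTop] fun k : ℕ => 1 / ((k : ℝ) + 1)) ∧ ∀ k, ∀ x ∈ K, |G k x| ≤ b k := by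
  refine ⟨fun k => ⨆ x : K, |G k x|, ?_, fun k x hx =>
    le_ciSup (f := fun x : K => |G k x|) ⟨B, forall_mem_range.mpr fun x => hB k x x.2⟩ ⟨x, hx⟩⟩
  refine isLittleO_iff.mpr fun ε hε => ?_
  filter_upwards [Metric.tendstoUniformlyOn_iff.mp hG ε hε] with k hk
  have hk1 : (0 : ℝ) < k + 1 := k.cast_add_one_pos
  rw [Real.norm_of_nonneg (Real.iSup_nonneg fun _ => abs_nonneg _),
    Real.norm_of_nonneg (one_div_pos.mpr hk1).le, mul_one_div]
  refine Real.iSup_le (fun x => ?_) (by positivity)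
  have hkx := (hk x x.2).le
  rwa [Pi.zero_apply, dist_zero_left, Real.norm_eq_abs, abs_mul, abs_of_pos hk1,
    ← le_div_iff₀' hk1] at hkx

theorem tendstoUniformlyOn_sum_mul_of_forall_cesaroSum_le {α : Type*} {K : Set α}
    {a : ℕ → α → ℝ} {φ b : ℕ → ℝ} {R A : ℝ}
    (hφ : Summable fun k : ℕ => ((k : ℝ) + 1) * |φ k - 2 * φ (k + 1) + φ (k + 2)|)
    (hlog : φ =O[atTop] fun k : ℕ => 1 / Real.log (k : ℝ))
    (hb : b =o[atTop] fun k : ℕ => 1 / ((k : ℝ) + 1)) (hA : 0 ≤ A)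
    (hbound : ∀ s < 2, ∀ n, ∀ x ∈ K, |cesaroSum s (a · x) n| ≤ R * (n : ℝ) ^ s +
      A * ∑ k ∈ Finset.range n, (((k : ℝ) + 2) ^ (s + 1) - ((k : ℝ) + 1) ^ (s + 1)) * b k) :
    TendstoUniformlyOn (fun n x => ∑ k ∈ Finset.range n, φ k * a k x)
      (fun x => ∑' k, (φ k - 2 * φ (k + 1) + φ (k + 2)) * cesaroSum 1 (a · x) (k + 1))
      atTop K := by
  have hconst : (fun _ : ℕ => R) =o[atTop] fun n : ℕ => Real.log n :=
    isLittleO_const_left.mpr <| .inr <| tendsto_norm_atTop_atTop.comp <|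
      Real.tendsto_log_atTop.comp tendsto_natCast_atTop_atTop
  obtain ⟨C, hC⟩ := exists_sum_range_sq_sub_mul_le hb
  refine tendstoUniformlyOn_sum_mul_of_cesaroSum_le (C := R + A * C) hφ hlog
    (hconst.add ((isLittleO_log_sum_range_of_isLittleO_one_div hb).const_mul_left A))
    (fun n x hx => ?_) fun n x hx => ?_
  · refine (hbound 0 zero_lt_two n x hx).trans_eq ?_
    simp only [pow_zero, mul_one, zero_add, pow_one, add_sub_add_left_eq_sub]
    norm_num
  · calc |cesaroSum 1 (a · x) n| ≤ _ := hbound 1 one_lt_two n x hx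
      _ ≤ R * n ^ 1 + A * (C * n) := by
        gcongr
        exact hC n
      _ = (R + A * C) * n := by ring

end Averages

section LocalAverages

variable {μ : Measure ℝ} {f g : ℝ → ℝ}

theorem integrable_abs_sub_mul (hf : AEStronglyMeasurable f μ) (hg : Integrable g μ)
    (hfg : Integrable (fun t => |f t| * g t) μ) (c : ℝ) :
    Integrable (fun t => |f t - c| * g t) μ := by
  refine (hfg.norm.add (hg.norm.const_mul |c|)).mono'
    ((hf.sub aestronglyMeasurable_const).norm.mul hg.aestronglyMeasurable) (ae_of_all _ fun t => ?_)
  simp only [Pi.add_apply, Real.norm_eq_abs, abs_mul, abs_abs, ← add_mul]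
  gcongr
  exact abs_sub _ _

theorem integral_abs_sub_mul_le (hf : AEStronglyMeasurable f μ) (hg : Integrable g μ)
    (hfg : Integrable (fun t => |f t| * g t) μ) (hg0 : 0 ≤ᵐ[μ] g) {c B : ℝ} (hc : |c| ≤ B) :
    ∫ t, |f t - c| * g t ∂μ ≤ (∫ t, |f t| * g t ∂μ) + B * ∫ t, g t ∂μ := by
  rw [← integral_const_mul, ← integral_add hfg (hg.const_mul B)]
  refine integral_mono_ae (integrable_abs_sub_mul hf hg hfg c) (hfg.add (hg.const_mul B)) ?_
  filter_upwards [hg0] with t ht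
  rw [← add_mul]
  exact mul_le_mul_of_nonneg_right ((abs_sub _ _).trans (by gcongr)) ht

theorem exists_isLittleO_setIntegral_abs_sub_mul_le (hf : AEStronglyMeasurable f μ)
    (hg : Integrable g μ) (hfg : Integrable (fun t => |f t| * g t) μ) (hg0 : 0 ≤ᵐ[μ] g)
    {K : Set ℝ} {c : ℝ → ℝ} {B : ℝ} (hc : ∀ x ∈ K, |c x| ≤ B)
    (hLeb : TendstoUniformlyOn (fun r x => r⁻¹ * ∫ t in Icc (x - r) (x + r), |f t - c x| * g t ∂μ)
      0 (𝓝[>] 0) K) :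
    ∃ b : ℕ → ℝ, (b =o[atTop] fun k : ℕ => 1 / ((k : ℝ) + 1)) ∧ ∀ k : ℕ, ∀ x ∈ K,
      ∫ t in Icc (x - 1 / ((k : ℝ) + 1)) (x + 1 / ((k : ℝ) + 1)), |f t - c x| * g t ∂μ ≤ b k := by
  have hnonneg : ∀ x, 0 ≤ᵐ[μ] fun t => |f t - c x| * g t := fun x =>
    hg0.mono fun t ht => mul_nonneg (abs_nonneg _) ht
  have hG : TendstoUniformlyOn (fun (k : ℕ) x => ((k : ℝ) + 1) *
      ∫ t in Icc (x - 1 / ((k : ℝ) + 1)) (x + 1 / ((k : ℝ) + 1)), |f t - c x| * g t ∂μ)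
      0 atTop K := fun u hu => by
    have hradius : Tendsto (fun k : ℕ => 1 / ((k : ℝ) + 1)) atTop (𝓝[>] 0) :=
      tendsto_nhdsWithin_iff.mpr ⟨tendsto_one_div_add_atTop_nhds_zero_nat,
        .of_forall fun k : ℕ => mem_Ioi.mpr (one_div_pos.mpr k.cast_add_one_pos)⟩
    simpa only [one_div, inv_inv] using hradius.eventually (hLeb u hu)
  obtain ⟨b, hb, hGb⟩ := exists_isLittleO_one_div_of_tendstoUniformlyOn (fun k x hx => by
    rw [abs_of_nonneg (integral_nonneg_of_ae (ae_restrict_of_ae (hnonneg x)))]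
    exact (setIntegral_le_integral (integrable_abs_sub_mul hf hg hfg (c x)) (hnonneg x)).trans
      (integral_abs_sub_mul_le hf hg hfg hg0 (hc x hx))) hG
  exact ⟨b, hb, fun k x hx => (le_abs_self _).trans (hGb k x hx)⟩

theorem mul_sum_ite_abs_sub_le_eq_sum_indicator {ι : Type*} (s : Finset ι) (w r : ι → ℝ)
    (H : ℝ → ℝ) (x t : ℝ) :
    H t * ∑ k ∈ s, (if |t - x| ≤ r k then w k else 0) =
      ∑ k ∈ s, w k * (Icc (x - r k) (x + r k)).indicator H t := by
  rw [Finset.mul_sum]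
  refine Finset.sum_congr rfl fun k _ => ?_
  have hmem : t ∈ Icc (x - r k) (x + r k) ↔ |t - x| ≤ r k := by
    rw [← Set.mem_Icc_iff_abs_le, abs_sub_comm]
  simp only [indicator_apply, hmem, mul_ite, mul_zero, mul_comm]

theorem abs_integral_le_of_abs_le_step {ι : Type*} {s : Finset ι} {w r : ι → ℝ} {F H : ℝ → ℝ}
    {x A : ℝ} (hH : Integrable H μ)
    (hF : ∀ᵐ t ∂μ, |F t| ≤ A * (H t * (1 + ∑ k ∈ s, if |t - x| ≤ r k then w k else 0))) :
    |∫ t, F t ∂μ| ≤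
      A * ((∫ t, H t ∂μ) + ∑ k ∈ s, w k * ∫ t in Icc (x - r k) (x + r k), H t ∂μ) := by
  have hterm : ∀ k ∈ s,
      Integrable (fun t => w k * (Icc (x - r k) (x + r k)).indicator H t) μ := fun k _ =>
    (hH.indicator measurableSet_Icc).const_mul _
  have hsum := integrable_finsetSum s hterm
  calc |∫ t, F t ∂μ|
      ≤ ∫ t, A * (H t + ∑ k ∈ s, w k * (Icc (x - r k) (x + r k)).indicator H t) ∂μ := by
        rw [← Real.norm_eq_abs]
        refine norm_integral_le_of_norm_le ((hH.add hsum).const_mul A) ?_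
        simpa only [mul_one_add, mul_sum_ite_abs_sub_le_eq_sum_indicator] using! hF
    _ = _ := by
        rw [integral_const_mul, integral_add hH hsum, integral_finsetSum s hterm]
        simp only [integral_const_mul, integral_indicator measurableSet_Icc]

end LocalAverages

namespace SobolevData

section Weight

variable (S : SobolevData)

instance : IsFiniteMeasure S.θ := S.finite

theorem ord_lt_ordStar (k : Fin S.m) : S.ord k < S.ordStar k := by
  unfold ordStar
  split_ifs <;> omega

theorem even_ordStar (k : Fin S.m) : Even (S.ordStar k) := by
  unfold ordStar
  split_ifs with h
  · exact h.add_one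
  · exact (Nat.not_odd_iff_even.mp h).add even_two

theorem w_nonneg (x : ℝ) : 0 ≤ S.w x :=
  Finset.prod_nonneg fun k _ => (S.even_ordStar k).pow_nonneg _

theorem w_pos {x : ℝ} (hx : x ∈ S.eps) : 0 < S.w x :=
  Finset.prod_pos fun k _ => (S.even_ordStar k).pow_pos <|
    sub_ne_zero.mpr fun h => hx.2 ⟨k, h.symm⟩

theorem continuous_w : Continuous S.w := by
  unfold w
  fun_prop

theorem isOpen_eps : IsOpen S.eps :=
  isOpen_Ioo.sdiff (finite_range S.a).isClosed

theorem eps_subset_Icc : S.eps ⊆ Icc (-1) 1 :=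
  sdiff_subset.trans Ioo_subset_Icc_self

theorem ae_mem_Icc : ∀ᵐ x ∂S.θ, x ∈ Icc (-1 : ℝ) 1 :=
  ae_iff.mpr S.carried

theorem primW_sub_primW (t x : ℝ) :
    S.primW t - S.primW x = (t - x) * ∫ s in (0 : ℝ)..1, S.w ((t - x) * s + x) := by
  have hint : ∀ a b, IntervalIntegrable S.w volume a b := S.continuous_w.intervalIntegrable
  rw [← smul_eq_mul, intervalIntegral.smul_integral_comp_mul_add, primW, primW,
    intervalIntegral.integral_interval_sub_left (hint _ _) (hint _ _)]
  simp

theorem integral_w_segment_pos {x : ℝ} (hx : x ∈ S.eps) (t : ℝ) :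
    0 < ∫ s in (0 : ℝ)..1, S.w ((t - x) * s + x) := by
  have hcont := S.continuous_w
  exact intervalIntegral.integral_pos one_pos (by fun_prop) (fun s _ => S.w_nonneg _)
    ⟨0, by simp, by simpa using S.w_pos hx⟩

theorem exists_abs_sub_le_mul_abs_primW_sub {K : Set ℝ} (hK : IsCompact K) (hKS : K ⊆ S.eps) :
    ∃ κ, 1 ≤ κ ∧ ∀ x ∈ K, ∀ t ∈ Icc (-1 : ℝ) 1, |t - x| ≤ κ * |S.primW t - S.primW x| := by
  have hcont : Continuous fun p : ℝ × ℝ => ∫ s in (0 : ℝ)..1, S.w ((p.2 - p.1) * s + p.1) := by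
    have hw := S.continuous_w
    exact intervalIntegral.continuous_parametric_intervalIntegral_of_continuous' (by fun_prop) _ _
  obtain ⟨ε, hε, hle⟩ := (hK.prod isCompact_Icc).exists_forall_le' hcont.continuousOn
    (a := 0) fun p hp => S.integral_w_segment_pos (hKS hp.1) p.2
  refine ⟨max 1 ε⁻¹, le_max_left _ _, fun x hx t ht => ?_⟩
  have hεI := hle (x, t) ⟨hx, ht⟩
  calc |t - x| = ε⁻¹ * (|t - x| * ε) := by field_simp
    _ ≤ max 1 ε⁻¹ * (|t - x| * |∫ s in (0 : ℝ)..1, S.w ((t - x) * s + x)|) := by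
      gcongr
      · exact le_max_right _ _
      · exact hεI.trans (le_abs_self _)
    _ = max 1 ε⁻¹ * |S.primW t - S.primW x| := by rw [primW_sub_primW, abs_mul]

theorem exists_pos_le_abs_a_sub {K : Set ℝ} (hK : IsCompact K) (hKS : K ⊆ S.eps) :
    ∃ δ > 0, ∀ k, ∀ x ∈ K, δ ≤ |S.a k - x| := by
  obtain ⟨δ, hδ, hsub⟩ := hK.exists_thickening_subset_open S.isOpen_eps hKS
  refine ⟨δ, hδ, fun k x hx => not_lt.mp fun hlt => ?_⟩
  exact (hsub (Metric.mem_thickening_iff.mpr ⟨x, hx, hlt⟩)).2 ⟨k, rfl⟩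

theorem exists_one_le_mul_abs_primW_a_sub {K : Set ℝ} (hK : IsCompact K) (hKS : K ⊆ S.eps) :
    ∃ κ, 1 ≤ κ ∧ ∀ k, ∀ x ∈ K, 1 ≤ κ * |S.primW (S.a k) - S.primW x| := by
  obtain ⟨κ, -, hle⟩ := S.exists_abs_sub_le_mul_abs_primW_sub hK hKS
  obtain ⟨δ, hδ, hdist⟩ := S.exists_pos_le_abs_a_sub hK hKS
  refine ⟨max 1 (κ / δ), le_max_left _ _, fun k x hx => ?_⟩
  calc 1 ≤ κ * |S.primW (S.a k) - S.primW x| / δ :=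
        (one_le_div hδ).mpr ((hdist k x hx).trans (hle x hx _ (S.a_mem k)))
    _ = κ / δ * |S.primW (S.a k) - S.primW x| := by ring
    _ ≤ max 1 (κ / δ) * |S.primW (S.a k) - S.primW x| := by gcongr; exact le_max_right _ _

end Weight

end SobolevData

section Polynomial

open Polynomial

theorem exists_polynomial_derivative_eq (P : ℝ[X]) : ∃ R : ℝ[X], derivative R = P := by
  induction P using Polynomial.induction_on' with
  | add P Q hP hQ =>
    obtain ⟨R, rfl⟩ := hP
    obtain ⟨T, rfl⟩ := hQ
    exact ⟨R + T, derivative_add⟩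
  | monomial n a =>
    refine ⟨monomial (n + 1) (a / (n + 1)), ?_⟩
    rw [derivative_monomial_succ, div_mul_cancel₀]
    positivity

theorem derivI_eval (P : ℝ[X]) (i : ℕ) {x : ℝ} (hx : x ∈ Icc (-1 : ℝ) 1) :
    derivI i (fun t => P.eval t) x = (derivative^[i] P).eval x := by
  unfold derivI
  induction i generalizing x with
  | zero => simp
  | succ i ih =>
    rw [iteratedDerivWithin_succ, derivWithin_congr (fun y hy => ih hy) (ih hx),
      Function.iterate_succ_apply', Polynomial.derivWithin]
    exact uniqueDiffOn_Icc (by norm_num) x hx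

namespace SobolevData

variable (S : SobolevData)

theorem M_nonneg_of_le {k : Fin S.m} {i : ℕ} (hi : i ≤ S.ord k) : 0 ≤ S.M k i := by
  rcases hi.lt_or_eq with hi | rfl
  · exact S.M_nonneg k i hi
  · exact (S.M_pos k).le

/-- The weight `w_N` as a polynomial. -/
noncomputable def wPoly : ℝ[X] := ∏ k, (X - C (S.a k)) ^ S.ordStar k

theorem eval_wPoly (x : ℝ) : S.wPoly.eval x = S.w x := by
  simp [wPoly, w, eval_prod]

theorem monic_wPoly : S.wPoly.Monic :=
  monic_prod_of_monic _ _ fun _ _ => (monic_X_sub_C _).pow _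

theorem natDegree_wPoly : S.wPoly.natDegree = S.N := by
  rw [wPoly, natDegree_prod_of_monic _ _ fun _ _ => (monic_X_sub_C _).pow _]
  simp [N]

/-- The primitive `π_{N+1}` of `w_N` as a polynomial. -/
noncomputable def primPoly : ℝ[X] :=
  (exists_polynomial_derivative_eq S.wPoly).choose -
    C ((exists_polynomial_derivative_eq S.wPoly).choose.eval (-1))

theorem derivative_primPoly : derivative S.primPoly = S.wPoly := by
  rw [primPoly, derivative_sub, derivative_C, sub_zero]
  exact (exists_polynomial_derivative_eq S.wPoly).choose_spec

theorem eval_primPoly (x : ℝ) : S.primPoly.eval x = S.primW x := by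
  rw [primW, intervalIntegral.integral_eq_sub_of_hasDerivAt (f := fun t => S.primPoly.eval t)]
  · simp [primPoly]
  · intro t _
    rw [← eval_wPoly, ← derivative_primPoly]
    exact S.primPoly.hasDerivAt t
  · exact S.continuous_w.intervalIntegrable _ _

theorem natDegree_primPoly : S.primPoly.natDegree = S.N + 1 := by
  have hdeg := natDegree_derivative S.primPoly
  rw [derivative_primPoly, natDegree_wPoly] at hdeg
  have hne : S.primPoly.natDegree ≠ 0 := fun h =>
    S.monic_wPoly.ne_zero (S.derivative_primPoly ▸ derivative_of_natDegree_zero h)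
  omega

theorem eval_iterate_derivative_primPoly_eq_zero {k : Fin S.m} {i : ℕ} (hi : i < S.ord k) :
    (derivative^[i + 1] S.primPoly).eval (S.a k) = 0 := by
  have hdvd : (X - C (S.a k)) ^ S.ordStar k ∣ S.wPoly :=
    Finset.dvd_prod_of_mem _ (Finset.mem_univ k)
  have hpos : S.ordStar k - i ≠ 0 := Nat.sub_ne_zero_of_lt (hi.trans (S.ord_lt_ordStar k))
  rw [Function.iterate_succ_apply, derivative_primPoly]
  exact dvd_iff_isRoot.mp
    ((dvd_pow_self _ hpos).trans (pow_sub_dvd_iterate_derivative_of_pow_dvd i hdvd))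

/-- The linear functional `P ↦ P^{(i)}(a_k)` on polynomials. -/
noncomputable def jet (k : Fin S.m) (i : ℕ) : ℝ[X] →ₗ[ℝ] ℝ :=
  leval (S.a k) ∘ₗ derivative ^ i

theorem jet_apply (k : Fin S.m) (i : ℕ) (P : ℝ[X]) :
    S.jet k i P = (derivative^[i] P).eval (S.a k) := by
  rw [jet, LinearMap.comp_apply, Module.End.pow_apply, leval_apply]

-- By Leibniz' rule: the derivatives of `π_{N+1}` of orders `1, …, N_k` vanish at `a_k`.
theorem jet_primPoly_mul {k : Fin S.m} {i : ℕ} (hi : i ≤ S.ord k) (P : ℝ[X]) :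
    S.jet k i (S.primPoly * P) = S.primW (S.a k) * S.jet k i P := by
  rw [jet_apply, iterate_derivative_mul, eval_finsetSum, Finset.sum_range_succ,
    Finset.sum_eq_zero, jet_apply]
  · simp [eval_primPoly]
  · intro j hj
    obtain ⟨r, hr⟩ := Nat.exists_eq_add_of_lt (Finset.mem_range.mp hj)
    have hzero := S.eval_iterate_derivative_primPoly_eq_zero (k := k) (i := r) (by omega)
    rw [eval_smul, eval_mul, show i - j = r + 1 by omega, hzero, zero_mul, smul_zero]

theorem integrable_mul_eval {f : ℝ → ℝ} (hf : Integrable f S.θ) (P : ℝ[X]) :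
    Integrable (fun x => f x * P.eval x) S.θ := by
  obtain ⟨B, hB⟩ := isCompact_Icc.exists_bound_of_continuousOn (s := Icc (-1 : ℝ) 1)
    P.continuous.continuousOn
  exact hf.mul_bdd P.continuous.aestronglyMeasurable (S.ae_mem_Icc.mono hB)

theorem integrable_eval (P : ℝ[X]) : Integrable (fun x => P.eval x) S.θ := by
  simpa using S.integrable_mul_eval (integrable_const (1 : ℝ)) P

variable {S} in
/-- The linear functional `P ↦ ∫ f P dθ` on polynomials. -/
noncomputable def integralPart {f : ℝ → ℝ} (hf : Integrable f S.θ) : ℝ[X] →ₗ[ℝ] ℝ where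
  toFun P := ∫ t, f t * P.eval t ∂S.θ
  map_add' P Q := by
    simp only [eval_add, mul_add]
    exact integral_add (S.integrable_mul_eval hf P) (S.integrable_mul_eval hf Q)
  map_smul' c P := by
    simp only [eval_smul, smul_eq_mul, mul_left_comm, integral_const_mul, RingHom.id_apply]

/-- The discrete part `P ↦ ∑_k ∑_{i ≤ N_k} M_{k,i} F_{k,i} P^{(i)}(a_k)` of the inner product,
with `F k i` standing for `f^{(i)}(a_k)`. -/
noncomputable def discretePart (F : Fin S.m → ℕ → ℝ) : ℝ[X] →ₗ[ℝ] ℝ :=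
  ∑ k, ∑ i ∈ Finset.range (S.ord k + 1), (S.M k i * F k i) • S.jet k i

variable {S} in
/-- The linear functional `⟨f, ·⟩` on polynomials. -/
noncomputable def ipFunctional {f : ℝ → ℝ} (hf : Integrable f S.θ) : ℝ[X] →ₗ[ℝ] ℝ :=
  integralPart hf + S.discretePart fun k i => derivI i f (S.a k)

theorem ipFunctional_apply {f : ℝ → ℝ} (hf : Integrable f S.θ) (P : ℝ[X]) :
    ipFunctional hf P = S.ip f fun x => P.eval x := by
  simp only [ipFunctional, integralPart, discretePart, ip, LinearMap.add_apply, LinearMap.coe_mk,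
    AddHom.coe_mk, LinearMap.sum_apply, LinearMap.smul_apply, smul_eq_mul, jet_apply,
    derivI_eval _ _ (S.a_mem _)]

/-- The linear functional `⟨P, ·⟩` on polynomials. -/
noncomputable def ipPoly (P : ℝ[X]) : ℝ[X] →ₗ[ℝ] ℝ := ipFunctional (S.integrable_eval P)

theorem ipPoly_apply (P Q : ℝ[X]) :
    S.ipPoly P Q = S.ip (fun x => P.eval x) fun x => Q.eval x :=
  S.ipFunctional_apply _ _

theorem ipPoly_eq_integral_add_sum_jet (P Q : ℝ[X]) : S.ipPoly P Q =
    (∫ x, P.eval x * Q.eval x ∂S.θ) + ∑ k, ∑ i ∈ Finset.range (S.ord k + 1),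
      S.M k i * S.jet k i P * S.jet k i Q := by
  simp only [ipPoly_apply, ip, jet_apply, derivI_eval _ _ (S.a_mem _)]

theorem ipPoly_comm (P Q : ℝ[X]) : S.ipPoly P Q = S.ipPoly Q P := by
  simp only [ipPoly_eq_integral_add_sum_jet, mul_comm (P.eval _), mul_right_comm _ (S.jet _ _ P)]

theorem ipPoly_primPoly_mul (P Q : ℝ[X]) :
    S.ipPoly P (S.primPoly * Q) = S.ipPoly (S.primPoly * P) Q := by
  simp only [ipPoly_eq_integral_add_sum_jet]
  congr 1
  · simp only [eval_mul, mul_left_comm, mul_assoc]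
  · refine Finset.sum_congr rfl fun k _ => Finset.sum_congr rfl fun i hi => ?_
    rw [S.jet_primPoly_mul (Finset.mem_range_succ_iff.mp hi),
      S.jet_primPoly_mul (Finset.mem_range_succ_iff.mp hi)]
    ring

end SobolevData

end Polynomial

section OrthonormalSystem

open Polynomial

namespace SobolevData

variable {S : SobolevData} {q : ℕ → ℝ[X]}

namespace IsOrthonormalSystem

theorem degree_eq (hq : S.IsOrthonormalSystem q) (n : ℕ) : (q n).degree = n := by
  rw [degree_eq_natDegree (leadingCoeff_ne_zero.mp (hq.1 n).2.ne'), (hq.1 n).1]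

theorem ipPoly_eq_ite (hq : S.IsOrthonormalSystem q) (n k : ℕ) :
    S.ipPoly (q n) (q k) = if n = k then 1 else 0 :=
  (S.ipPoly_apply _ _).trans (hq.2 n k)

theorem eq_sum_ipPoly_smul (hq : S.IsOrthonormalSystem q) {n : ℕ} {P : ℝ[X]} (hP : P.degree < n) :
    P = ∑ m ∈ Finset.range n, S.ipPoly (q m) P • q m := by
  have hspan : P ∈ Submodule.span ℝ (q '' Iio n) := by
    let basis : Polynomial.Sequence ℝ := ⟨q, hq.degree_eq⟩
    have hunit : ∀ i < n, IsUnit (basis i).leadingCoeff := fun i _ => (hq.1 i).2.ne'.isUnit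
    change P ∈ Submodule.span ℝ (basis '' Iio n)
    rw [basis.span_degreeLT hunit]
    exact mem_degreeLT.mpr hP
  let expansion : ℝ[X] →ₗ[ℝ] ℝ[X] :=
    ∑ m ∈ Finset.range n, (S.ipPoly (q m)).smulRight (q m)
  have hfix : EqOn (LinearMap.id : ℝ[X] →ₗ[ℝ] ℝ[X]) expansion (q '' Iio n) := by
    rintro _ ⟨j, hj, rfl⟩
    simp only [expansion, LinearMap.id_apply, LinearMap.sum_apply, LinearMap.smulRight_apply,
      hq.ipPoly_eq_ite, ite_smul, one_smul, zero_smul, Finset.sum_ite_eq', Finset.mem_range]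
    rw [if_pos (mem_Iio.mp hj)]
  simpa [expansion] using LinearMap.eqOn_span hfix hspan

theorem ipPoly_eq_zero_of_degree_lt (hq : S.IsOrthonormalSystem q) {n : ℕ} {P : ℝ[X]}
    (hP : P.degree < n) : S.ipPoly (q n) P = 0 := by
  rw [hq.eq_sum_ipPoly_smul hP, map_sum]
  refine Finset.sum_eq_zero fun j hj => ?_
  rw [map_smul, hq.ipPoly_eq_ite, if_neg (Finset.mem_range.mp hj).ne', smul_zero]

end IsOrthonormalSystem

variable (S q) in
/-- The matrix of multiplication by `π_{N+1}` in the basis `q`. -/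
noncomputable def mulMatrix (n m : ℕ) : ℝ := S.ipPoly (q m) (S.primPoly * q n)

theorem mulMatrix_comm (n m : ℕ) : S.mulMatrix q n m = S.mulMatrix q m n := by
  rw [mulMatrix, mulMatrix, ipPoly_primPoly_mul, ipPoly_comm]

theorem recCoeff_add_eq_mulMatrix (n l : ℕ) : S.recCoeff q (n + l) l = S.mulMatrix q n (n + l) := by
  rw [mulMatrix, ipPoly_primPoly_mul, ipPoly_apply, recCoeff,
    if_pos (Nat.le_add_left l n), Nat.add_sub_cancel]
  simp only [eval_mul, eval_primPoly]

namespace IsOrthonormalSystem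

theorem degree_primPoly_mul_lt (hq : S.IsOrthonormalSystem q) {n m : ℕ} (h : n + (S.N + 1) < m) :
    (S.primPoly * q n).degree < m := by
  have hle : (S.primPoly * q n).natDegree ≤ n + (S.N + 1) := by
    grw [natDegree_mul_le, natDegree_primPoly, (hq.1 n).1, add_comm]
  exact (degree_le_of_natDegree_le hle).trans_lt (Nat.cast_lt.mpr h)

theorem mulMatrix_eq_zero (hq : S.IsOrthonormalSystem q) {n m : ℕ} (h : n + (S.N + 1) < m) :
    S.mulMatrix q n m = 0 :=
  hq.ipPoly_eq_zero_of_degree_lt (hq.degree_primPoly_mul_lt h)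

theorem primPoly_mul_eq_sum (hq : S.IsOrthonormalSystem q) (n : ℕ) :
    S.primPoly * q n = ∑ m ∈ Finset.range (n + (S.N + 1) + 1), S.mulMatrix q n m • q m :=
  hq.eq_sum_ipPoly_smul (hq.degree_primPoly_mul_lt (Nat.lt_succ_self _))

theorem isRecurrenceSolution (hq : S.IsOrthonormalSystem q) {Λ : ℝ[X] →ₗ[ℝ] ℝ} {z : ℝ}
    (hΛ : ∀ P, Λ (S.primPoly * P) = z * Λ P) :
    IsRecurrenceSolution (S.mulMatrix q) (S.N + 1) z fun n => Λ (q n) := fun n => by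
  simp only [← hΛ, hq.primPoly_mul_eq_sum, map_sum, map_smul, smul_eq_mul]

theorem isRecurrenceSolution_eval (hq : S.IsOrthonormalSystem q) (t : ℝ) :
    IsRecurrenceSolution (S.mulMatrix q) (S.N + 1) (S.primW t) fun n => (q n).eval t :=
  hq.isRecurrenceSolution (Λ := leval t) fun P => by simp [eval_primPoly]

theorem isRecurrenceSolution_jet (hq : S.IsOrthonormalSystem q) {k : Fin S.m} {i : ℕ}
    (hi : i ≤ S.ord k) :
    IsRecurrenceSolution (S.mulMatrix q) (S.N + 1) (S.primW (S.a k)) fun n => S.jet k i (q n) :=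
  hq.isRecurrenceSolution (S.jet_primPoly_mul hi)

theorem exists_hasKernelBound_mulMatrix (hq : S.IsOrthonormalSystem q)
    (hBV : ∀ l ≤ S.N + 1,
      Summable fun s => |S.recCoeff q (s + l) l - S.recCoeff q (s + 1 + l) l|) :
    ∃ C, 1 ≤ C ∧ HasKernelBound (S.mulMatrix q) (S.N + 1) C := by
  refine exists_hasKernelBound mulMatrix_comm (fun n m h => ?_) fun l => ?_
  · rw [mulMatrix_comm, hq.mulMatrix_eq_zero h]
  · rcases le_or_gt l (S.N + 1) with hl | hl
    · simpa only [recCoeff_add_eq_mulMatrix] using hBV l hl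
    · simp [hq.mulMatrix_eq_zero (Nat.add_lt_add_left hl _), summable_zero]

theorem integral_sq_add_sum_jet_sq_eq_one (hq : S.IsOrthonormalSystem q) (n : ℕ) :
    (∫ x, (q n).eval x ^ 2 ∂S.θ) + ∑ k, ∑ i ∈ Finset.range (S.ord k + 1),
      S.M k i * S.jet k i (q n) ^ 2 = 1 := by
  have hnorm := hq.ipPoly_eq_ite n n
  rw [if_pos rfl, ipPoly_eq_integral_add_sum_jet] at hnorm
  simpa only [pow_two, mul_assoc] using hnorm

theorem integral_sq_le_one (hq : S.IsOrthonormalSystem q) (n : ℕ) :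
    ∫ x, (q n).eval x ^ 2 ∂S.θ ≤ 1 := by
  rw [← hq.integral_sq_add_sum_jet_sq_eq_one n]
  exact le_add_of_nonneg_right <| Finset.sum_nonneg fun k _ => Finset.sum_nonneg fun i hi =>
    mul_nonneg (S.M_nonneg_of_le (Finset.mem_range_succ_iff.mp hi)) (sq_nonneg _)

theorem M_mul_jet_sq_le_one (hq : S.IsOrthonormalSystem q) (n : ℕ) {k : Fin S.m} {i : ℕ}
    (hi : i ≤ S.ord k) : S.M k i * S.jet k i (q n) ^ 2 ≤ 1 := by
  have hterm : ∀ k, ∀ i ∈ Finset.range (S.ord k + 1), 0 ≤ S.M k i * S.jet k i (q n) ^ 2 :=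
    fun k i hi => mul_nonneg (S.M_nonneg_of_le (Finset.mem_range_succ_iff.mp hi)) (sq_nonneg _)
  calc S.M k i * S.jet k i (q n) ^ 2
      ≤ ∑ i ∈ Finset.range (S.ord k + 1), S.M k i * S.jet k i (q n) ^ 2 :=
        Finset.single_le_sum (hterm k) (Finset.mem_range_succ_iff.mpr hi)
    _ ≤ ∑ k, ∑ i ∈ Finset.range (S.ord k + 1), S.M k i * S.jet k i (q n) ^ 2 :=
        Finset.single_le_sum (f := fun k => ∑ i ∈ Finset.range (S.ord k + 1), _)
          (fun k _ => Finset.sum_nonneg (hterm k)) (Finset.mem_univ k)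
    _ ≤ 1 := by
        rw [← hq.integral_sq_add_sum_jet_sq_eq_one n]
        exact le_add_of_nonneg_left (integral_nonneg fun x => sq_nonneg _)

theorem exists_abs_jet_le (hq : S.IsOrthonormalSystem q) {k : Fin S.m} {i : ℕ}
    (hM : 0 < S.M k i) (hi : i ≤ S.ord k) : ∃ U, ∀ n, |S.jet k i (q n)| ≤ U := by
  refine ⟨√(1 / S.M k i), fun n => Real.abs_le_sqrt ?_⟩
  rw [le_div_iff₀' hM]
  exact hq.M_mul_jet_sq_le_one n hi

theorem exists_abs_eval_le_of_measure_singleton_ne_zero (hq : S.IsOrthonormalSystem q) {t : ℝ}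
    (ht : S.θ {t} ≠ 0) : ∃ U, ∀ n, |(q n).eval t| ≤ U := by
  have hpos : 0 < S.θ.real {t} := ENNReal.toReal_pos ht (measure_ne_top _ _)
  refine ⟨√(1 / S.θ.real {t}), fun n => Real.abs_le_sqrt ?_⟩
  rw [le_div_iff₀' hpos]
  have hint : Integrable (fun x => (q n).eval x ^ 2) S.θ :=
    (S.integrable_eval (q n ^ 2)).congr (ae_of_all _ fun x => eval_pow 2)
  calc S.θ.real {t} * (q n).eval t ^ 2 = ∫ x in {t}, (q n).eval x ^ 2 ∂S.θ := by
        rw [integral_singleton, smul_eq_mul]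
    _ ≤ ∫ x, (q n).eval x ^ 2 ∂S.θ :=
        setIntegral_le_integral hint (ae_of_all _ fun x => sq_nonneg _)
    _ ≤ 1 := hq.integral_sq_le_one n

end IsOrthonormalSystem

variable (q) in
/-- The kernel `t ↦ ∑_{i < n} (n - i)^s q_i(x) q_i(t)`, a Dirichlet kernel for `s = 0` and a
(not normalized) Fejér kernel for `s = 1`. -/
noncomputable def kernelPoly (s n : ℕ) (x : ℝ) : ℝ[X] :=
  ∑ i ∈ Finset.range n, (((n : ℝ) - i) ^ s * (q i).eval x) • q i

theorem map_kernelPoly (Λ : ℝ[X] →ₗ[ℝ] ℝ) (s n : ℕ) (x : ℝ) :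
    Λ (kernelPoly q s n x) = cesaroSum s (fun i => Λ (q i) * (q i).eval x) n := by
  simp only [kernelPoly, cesaroSum, map_sum, map_smul, smul_eq_mul, mul_assoc,
    mul_comm (Λ _)]

namespace IsOrthonormalSystem

theorem ipPoly_one_mul_eval (hq : S.IsOrthonormalSystem q) (i : ℕ) (x : ℝ) :
    S.ipPoly 1 (q i) * (q i).eval x = if i = 0 then 1 else 0 := by
  rw [ipPoly_comm]
  split_ifs with hi
  · have hexp := hq.eq_sum_ipPoly_smul (n := 1) (P := 1) (by simp)
    simpa [hi] using (congrArg (eval x) hexp).symm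
  · rw [hq.ipPoly_eq_zero_of_degree_lt (by simpa using Nat.pos_of_ne_zero hi), zero_mul]

theorem ipPoly_one_kernelPoly (hq : S.IsOrthonormalSystem q) (s : ℕ) {n : ℕ} (hn : 0 < n) (x : ℝ) :
    S.ipPoly 1 (kernelPoly q s n x) = (n : ℝ) ^ s := by
  simp [map_kernelPoly, hq.ipPoly_one_mul_eval, cesaroSum, hn]

theorem exists_abs_M_mul_jet_kernelPoly_le (hq : S.IsOrthonormalSystem q) {C : ℝ}
    (hC : HasKernelBound (S.mulMatrix q) (S.N + 1) C) {K : Set ℝ} (hK : IsCompact K)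
    (hKS : K ⊆ S.eps) {V : ℝ} (hV : ∀ x ∈ K, ∀ j, |(q j).eval x| ≤ V) {k : Fin S.m} {i : ℕ}
    (hi : i ≤ S.ord k) :
    ∃ D, ∀ s < 2, ∀ n, ∀ x ∈ K, |S.M k i * S.jet k i (kernelPoly q s n x)| ≤ D := by
  rcases (S.M_nonneg_of_le hi).eq_or_lt with hM | hM
  · exact ⟨0, fun s _ n x _ => by simp [← hM]⟩
  obtain ⟨U, hU⟩ := hq.exists_abs_jet_le hM hi
  obtain ⟨κ, hκ, hdist⟩ := S.exists_one_le_mul_abs_primW_a_sub hK hKS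
  refine ⟨S.M k i * (κ ^ 2 * (C * U * V)), fun s hs n x hx => ?_⟩
  rw [abs_mul, abs_of_pos hM, map_kernelPoly]
  have hbound := hC s hs n _ _ _ _ U V (hq.isRecurrenceSolution_jet hi)
    (hq.isRecurrenceSolution_eval x) hU (hV x hx)
  set Z := cesaroSum s (fun i' => S.jet k i (q i') * (q i').eval x) n
  gcongr
  calc |Z| ≤ (κ * |S.primW (S.a k) - S.primW x|) ^ (s + 1) * |Z| :=
        le_mul_of_one_le_left (abs_nonneg _) (one_le_pow₀ (hdist k x hx))
    _ = κ ^ (s + 1) * (|S.primW (S.a k) - S.primW x| ^ (s + 1) * |Z|) := by ring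
    _ ≤ κ ^ (s + 1) * (C * U * V) := by gcongr
    _ ≤ κ ^ 2 * (C * U * V) :=
        mul_le_mul_of_nonneg_right (pow_le_pow_right₀ hκ hs) (le_trans (by positivity) hbound)

theorem exists_abs_discretePart_kernelPoly_le (hq : S.IsOrthonormalSystem q) {C : ℝ}
    (hC : HasKernelBound (S.mulMatrix q) (S.N + 1) C) {K : Set ℝ} (hK : IsCompact K)
    (hKS : K ⊆ S.eps) {V : ℝ} (hV : ∀ x ∈ K, ∀ j, |(q j).eval x| ≤ V)
    (F : Fin S.m → ℕ → ℝ) :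
    ∃ D, ∀ s < 2, ∀ n, ∀ x ∈ K, |S.discretePart F (kernelPoly q s n x)| ≤ D := by
  have hjet : ∀ k i, ∃ D, i ≤ S.ord k → ∀ s < 2, ∀ n, ∀ x ∈ K,
      |S.M k i * S.jet k i (kernelPoly q s n x)| ≤ D := fun k i => by
    by_cases hi : i ≤ S.ord k
    · exact (hq.exists_abs_M_mul_jet_kernelPoly_le hC hK hKS hV hi).imp fun D hD _ => hD
    · exact ⟨0, fun h => absurd h hi⟩
  choose D hD using hjet
  refine ⟨∑ k, ∑ i ∈ Finset.range (S.ord k + 1), |F k i| * D k i, fun s hs n x hx => ?_⟩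
  simp only [discretePart, LinearMap.sum_apply, LinearMap.smul_apply, smul_eq_mul]
  refine (Finset.abs_sum_le_sum_abs _ _).trans (Finset.sum_le_sum fun k _ => ?_)
  refine (Finset.abs_sum_le_sum_abs _ _).trans (Finset.sum_le_sum fun i hi => ?_)
  rw [mul_right_comm, mul_comm, abs_mul]
  exact mul_le_mul_of_nonneg_left (hD k i (Finset.mem_range_succ_iff.mp hi) s hs n x hx)
    (abs_nonneg _)

end IsOrthonormalSystem

end SobolevData

end OrthonormalSystem

section Convergence

open Polynomial

namespace SobolevData

/-- The sum of the series `∑ φ_k c_k(f) q_k(x)`, written as the absolutely convergent series of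
`Δ²φ_k` times the Cesàro sums which Abel summation, applied twice, produces. -/
noncomputable def multLimit (S : SobolevData) (q : ℕ → ℝ[X]) (φ : ℕ → ℝ) (f : ℝ → ℝ) (x : ℝ) : ℝ :=
  ∑' k, (φ k - 2 * φ (k + 1) + φ (k + 2)) *
    cesaroSum 1 (fun i => S.coeff q f i * (q i).eval x) (k + 1)

variable {S : SobolevData} {q : ℕ → ℝ[X]} {f g : ℝ → ℝ}

theorem cesaroSum_coeff_mul_eval (hf : Integrable f S.θ) (s n : ℕ) (x : ℝ) :
    cesaroSum s (fun i => S.coeff q f i * (q i).eval x) n =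
      ipFunctional hf (kernelPoly q s n x) := by
  simp only [map_kernelPoly, ipFunctional_apply, coeff]

theorem ipFunctional_eq_integral_sub_mul_add (hf : Integrable f S.θ) (c : ℝ) (P : ℝ[X]) :
    ipFunctional hf P = (∫ t, (f t - c) * P.eval t ∂S.θ) +
      S.discretePart (fun k i => derivI i f (S.a k)) P + c * (S.ipPoly 1 P -
        S.discretePart (fun k i => derivI i (fun t => (1 : ℝ[X]).eval t) (S.a k)) P) := by
  have hsplit : ∫ t, (f t - c) * P.eval t ∂S.θ =
      (∫ t, f t * P.eval t ∂S.θ) - c * ∫ t, P.eval t ∂S.θ := by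
    rw [← integral_const_mul, ← integral_sub (S.integrable_mul_eval hf P)
      ((S.integrable_eval P).const_mul c)]
    simp only [sub_mul]
  simp only [hsplit, ipPoly, ipFunctional, integralPart, LinearMap.add_apply, LinearMap.coe_mk,
    AddHom.coe_mk, eval_one, one_mul]
  ring

namespace IsOrthonormalSystem

theorem abs_eval_kernelPoly_le (hq : S.IsOrthonormalSystem q) {C : ℝ} (hC1 : 1 ≤ C)
    (hC : HasKernelBound (S.mulMatrix q) (S.N + 1) C) {t x κ U V : ℝ} (hκ : 1 ≤ κ)
    (hdist : |t - x| ≤ κ * |S.primW t - S.primW x|) (hU : ∀ j, |(q j).eval t| ≤ U)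
    (hV : ∀ j, |(q j).eval x| ≤ V) {s : ℕ} (hs : s < 2) (n : ℕ) :
    |(kernelPoly q s n x).eval t| ≤ κ ^ 2 * C * V * (U * (1 + ∑ k ∈ Finset.range n,
      if |t - x| ≤ 1 / ((k : ℝ) + 1) then ((k : ℝ) + 2) ^ (s + 1) - ((k : ℝ) + 1) ^ (s + 1)
      else 0)) := by
  have hbound := hC.abs_cesaroSum_le hC1 hs (hq.isRecurrenceSolution_eval t)
    (hq.isRecurrenceSolution_eval x) hU hV (abs_nonneg _) hκ hdist n
  have hU0 : 0 ≤ U := (abs_nonneg _).trans (hU 0)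
  have hV0 : 0 ≤ V := (abs_nonneg _).trans (hV 0)
  have hsum : 0 ≤ ∑ k ∈ Finset.range n, if |t - x| ≤ 1 / ((k : ℝ) + 1) then
      ((k : ℝ) + 2) ^ (s + 1) - ((k : ℝ) + 1) ^ (s + 1) else 0 :=
    Finset.sum_nonneg fun k _ => by
      split_ifs
      · exact sub_nonneg.mpr (by gcongr; norm_num)
      · exact le_rfl
  rw [← leval_apply, map_kernelPoly]
  refine hbound.trans ?_
  rw [mul_comm U V, ← mul_assoc, ← mul_assoc]
  gcongr
  exact hs

theorem abs_integral_sub_mul_kernelPoly_le (hq : S.IsOrthonormalSystem q) {C : ℝ} (hC1 : 1 ≤ C)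
    (hC : HasKernelBound (S.mulMatrix q) (S.N + 1) C) (hf : AEStronglyMeasurable f S.θ)
    (hg : Integrable g S.θ) (hfg : Integrable (fun t => |f t| * g t) S.θ)
    (hqg : ∀ᵐ t ∂S.θ, ∀ j, |(q j).eval t| ≤ g t) {x κ V : ℝ} (hκ : 1 ≤ κ)
    (hdist : ∀ t ∈ Icc (-1) 1, |t - x| ≤ κ * |S.primW t - S.primW x|)
    (hV : ∀ j, |(q j).eval x| ≤ V) (c : ℝ) {s : ℕ} (hs : s < 2) (n : ℕ) :
    |∫ t, (f t - c) * (kernelPoly q s n x).eval t ∂S.θ| ≤ κ ^ 2 * C * V *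
      ((∫ t, |f t - c| * g t ∂S.θ) + ∑ k ∈ Finset.range n,
        (((k : ℝ) + 2) ^ (s + 1) - ((k : ℝ) + 1) ^ (s + 1)) *
          ∫ t in Icc (x - 1 / ((k : ℝ) + 1)) (x + 1 / ((k : ℝ) + 1)), |f t - c| * g t ∂S.θ) := by
  refine abs_integral_le_of_abs_le_step (integrable_abs_sub_mul hf hg hfg c) ?_
  filter_upwards [hqg, S.ae_mem_Icc] with t ht htI
  rw [abs_mul, mul_assoc |f t - c|, mul_left_comm _ |f t - c|]
  gcongr
  exact hq.abs_eval_kernelPoly_le hC1 hC hκ (hdist t htI) ht hV hs n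

theorem exists_abs_cesaroSum_coeff_le (hq : S.IsOrthonormalSystem q) {C : ℝ} (hC1 : 1 ≤ C)
    (hC : HasKernelBound (S.mulMatrix q) (S.N + 1) C) (hf : Integrable f S.θ)
    (hg : Integrable g S.θ) (hfg : Integrable (fun t => |f t| * g t) S.θ)
    (hqg : ∀ᵐ t ∂S.θ, ∀ j, |(q j).eval t| ≤ g t) {K : Set ℝ} (hK : IsCompact K)
    (hKS : K ⊆ S.eps) {c : ℝ → ℝ} {V B : ℝ} (hV : ∀ x ∈ K, ∀ j, |(q j).eval x| ≤ V)
    (hc : ∀ x ∈ K, |c x| ≤ B) :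
    ∃ R A, 0 ≤ A ∧ ∀ s < 2, ∀ n, ∀ x ∈ K,
      |cesaroSum s (fun i => S.coeff q f i * (q i).eval x) n| ≤ R * (n : ℝ) ^ s +
        A * ∑ k ∈ Finset.range n, (((k : ℝ) + 2) ^ (s + 1) - ((k : ℝ) + 1) ^ (s + 1)) *
          ∫ t in Icc (x - 1 / ((k : ℝ) + 1)) (x + 1 / ((k : ℝ) + 1)), |f t - c x| * g t ∂S.θ := by
  obtain ⟨κ, hκ, hdist⟩ := S.exists_abs_sub_le_mul_abs_primW_sub hK hKS
  obtain ⟨D, hD⟩ := hq.exists_abs_discretePart_kernelPoly_le hC hK hKS hV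
    fun k i => derivI i f (S.a k)
  obtain ⟨D₁, hD₁⟩ := hq.exists_abs_discretePart_kernelPoly_le hC hK hKS hV
    fun k i => derivI i (fun t => (1 : ℝ[X]).eval t) (S.a k)
  have hg0 : 0 ≤ᵐ[S.θ] g := hqg.mono fun t ht => (abs_nonneg _).trans (ht 0)
  set A := κ ^ 2 * C * |V|
  set G := (∫ t, |f t| * g t ∂S.θ) + B * ∫ t, g t ∂S.θ
  refine ⟨A * G + D + B * (1 + D₁), A, by positivity, fun s hs n x hx => ?_⟩
  have hB : 0 ≤ B := (abs_nonneg _).trans (hc x hx)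
  have hG : ∫ t, |f t - c x| * g t ∂S.θ ≤ G :=
    integral_abs_sub_mul_le hf.aestronglyMeasurable hg hfg hg0 (hc x hx)
  have hG0 : 0 ≤ G := hG.trans' <|
    integral_nonneg_of_ae (hg0.mono fun t ht => mul_nonneg (abs_nonneg _) ht)
  have hDn := hD s hs n x hx
  have hD₁n := hD₁ s hs n x hx
  have hD0 : 0 ≤ D := (abs_nonneg _).trans hDn
  have hD₁0 : 0 ≤ D₁ := (abs_nonneg _).trans hD₁n
  rcases n.eq_zero_or_pos with rfl | hn
  · simpa [cesaroSum] using by positivity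
  have hn1 : (1 : ℝ) ≤ (n : ℝ) ^ s := one_le_pow₀ (Nat.one_le_cast.mpr hn)
  have hintegral := hq.abs_integral_sub_mul_kernelPoly_le hC1 hC hf.aestronglyMeasurable hg hfg hqg
    hκ (hdist x hx) (fun j => (hV x hx j).trans (le_abs_self V)) (c x) hs n
  rw [cesaroSum_coeff_mul_eval hf, ipFunctional_eq_integral_sub_mul_add hf (c x),
    hq.ipPoly_one_kernelPoly s hn]
  have hmean : |c x * ((n : ℝ) ^ s - S.discretePart (fun k i => derivI i
      (fun t => (1 : ℝ[X]).eval t) (S.a k)) (kernelPoly q s n x))| ≤ B * ((n : ℝ) ^ s + D₁) := by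
    rw [abs_mul]
    gcongr
    · exact hc x hx
    · grw [abs_sub, hD₁n, abs_of_nonneg (by positivity)]
  grw [abs_add_three, hintegral, hDn, hmean, hG, mul_add]
  have := le_mul_of_one_le_right (by positivity : 0 ≤ A * G + D + B * D₁) hn1
  linarith

theorem tendstoUniformlyOn_multSum (hq : S.IsOrthonormalSystem q)
    (hBV : ∀ l ≤ S.N + 1,
      Summable fun s => |S.recCoeff q (s + l) l - S.recCoeff q (s + 1 + l) l|)
    {φ : ℕ → ℝ} (hφ : Summable fun k : ℕ => ((k : ℝ) + 1) * |φ k - 2 * φ (k + 1) + φ (k + 2)|)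
    (hlog : φ =O[atTop] fun k : ℕ => 1 / Real.log (k : ℝ)) (hf : Integrable f S.θ)
    (hg : Integrable g S.θ) (hfg : Integrable (fun t => |f t| * g t) S.θ)
    (hqg : ∀ᵐ t ∂S.θ, ∀ j, |(q j).eval t| ≤ g t) {K : Set ℝ} (hK : IsCompact K)
    (hKS : K ⊆ S.eps) {c : ℝ → ℝ} {V B : ℝ} (hV : ∀ x ∈ K, ∀ j, |(q j).eval x| ≤ V)
    (hc : ∀ x ∈ K, |c x| ≤ B)
    (hLeb : TendstoUniformlyOn
      (fun r x => r⁻¹ * ∫ t in Icc (x - r) (x + r), |f t - c x| * g t ∂S.θ) 0 (𝓝[>] 0) K) :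
    TendstoUniformlyOn (S.multSum q φ f) (S.multLimit q φ f) atTop K := by
  obtain ⟨C, hC1, hC⟩ := hq.exists_hasKernelBound_mulMatrix hBV
  obtain ⟨R, A, hA, hbound⟩ := hq.exists_abs_cesaroSum_coeff_le hC1 hC hf hg hfg hqg hK hKS hV hc
  obtain ⟨b, hb, hGb⟩ := exists_isLittleO_setIntegral_abs_sub_mul_le hf.aestronglyMeasurable hg hfg
    (hqg.mono fun t ht => (abs_nonneg _).trans (ht 0)) hc hLeb
  have hconv := tendstoUniformlyOn_sum_mul_of_forall_cesaroSum_le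
    (a := fun i x => S.coeff q f i * (q i).eval x) hφ hlog hb hA fun s hs n x hx => by
      refine (hbound s hs n x hx).trans ?_
      gcongr with k
      · exact sub_nonneg.mpr (by gcongr; norm_num)
      · exact hGb k x hx
  exact hconv.congr (.of_forall fun n x _ => by simp only [multSum, mul_assoc])

end IsOrthonormalSystem

end SobolevData

end Convergence

section LebesguePoints

variable {μ : Measure ℝ} {f g : ℝ → ℝ}

theorem ae_tendsto_inv_mul_setIntegral_Icc [IsFiniteMeasure μ] (hg : Measurable g)
    (hg0 : ∀ t, 0 ≤ g t) (hint : Integrable g μ) :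
    ∀ᵐ x, Tendsto (fun r => r⁻¹ * ∫ t in Icc (x - r) (x + r), g t ∂μ) (𝓝[>] 0)
      (𝓝 (g x * (2 * (μ.rnDeriv volume x).toReal))) := by
  set ν := μ.withDensity fun t => ENNReal.ofReal (g t) with hν
  have : IsFiniteMeasure ν := isFiniteMeasure_withDensity_ofReal hint.hasFiniteIntegral
  have hchain : ν.rnDeriv volume =ᵐ[volume] fun x => ENNReal.ofReal (g x) * μ.rnDeriv volume x :=
    Measure.rnDeriv_withDensity_left hg.ennreal_ofReal.aemeasurable
      (ae_of_all _ fun _ => ENNReal.ofReal_ne_top)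
  filter_upwards [Besicovitch.ae_tendsto_rnDeriv ν volume, hchain, ν.rnDeriv_lt_top volume]
    with x hlim hx hfin
  have hreal := ((ENNReal.tendsto_toReal hfin.ne).comp hlim).const_mul 2
  rw [hx, ENNReal.toReal_mul, ENNReal.toReal_ofReal (hg0 x), mul_left_comm] at hreal
  refine hreal.congr' ?_
  filter_upwards [self_mem_nhdsWithin] with r (hr : 0 < r)
  have hball : ν (Metric.closedBall x r) =
      ENNReal.ofReal (∫ t in Icc (x - r) (x + r), g t ∂μ) := by
    rw [Real.closedBall_eq_Icc, hν, withDensity_apply _ measurableSet_Icc,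
      ofReal_integral_eq_lintegral_ofReal hint.restrict (ae_of_all _ hg0)]
  rw [Function.comp_apply, hball, Real.volume_closedBall, ENNReal.toReal_div,
    ENNReal.toReal_ofReal (integral_nonneg hg0), ENNReal.toReal_ofReal (by positivity)]
  field_simp

theorem tendsto_inv_mul_setIntegral_abs_sub_mul_of_forall_rat (hf : AEStronglyMeasurable f μ)
    (hg : Integrable g μ) (hfg : Integrable (fun t => |f t| * g t) μ) (hg0 : 0 ≤ᵐ[μ] g)
    {x y d : ℝ} (hgd : Tendsto (fun r => r⁻¹ * ∫ t in Icc (x - r) (x + r), g t ∂μ) (𝓝[>] 0) (𝓝 d))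
    (hfd : ∀ a : ℚ, Tendsto (fun r => r⁻¹ * ∫ t in Icc (x - r) (x + r), |f t - a| * g t ∂μ)
      (𝓝[>] 0) (𝓝 (|y - a| * d))) :
    Tendsto (fun r => r⁻¹ * ∫ t in Icc (x - r) (x + r), |f t - y| * g t ∂μ) (𝓝[>] 0) (𝓝 0) := by
  have hint := integrable_abs_sub_mul hf hg hfg
  have hle : ∀ a : ℚ, ∀ r : ℝ, ∫ t in Icc (x - r) (x + r), |f t - y| * g t ∂μ ≤
      (∫ t in Icc (x - r) (x + r), |f t - a| * g t ∂μ) +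
        |y - a| * ∫ t in Icc (x - r) (x + r), g t ∂μ := fun a r => by
    rw [← integral_const_mul, ← integral_add (hint a).integrableOn (hg.const_mul _).integrableOn]
    refine integral_mono_ae (hint y).integrableOn
      ((hint a).integrableOn.add (hg.const_mul _).integrableOn) (ae_restrict_of_ae ?_)
    filter_upwards [hg0] with t ht
    rw [← add_mul, abs_sub_comm y]
    exact mul_le_mul_of_nonneg_right (abs_sub_le _ _ _) ht
  refine tendsto_order.mpr ⟨fun ε hε => ?_, fun ε hε => ?_⟩
  · filter_upwards [self_mem_nhdsWithin] with r (hr : 0 < r)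
    exact hε.trans_le <| mul_nonneg (inv_nonneg.mpr hr.le) <| integral_nonneg_of_ae <|
      ae_restrict_of_ae <| hg0.mono fun t ht => mul_nonneg (abs_nonneg _) ht
  · have hnear : ∀ᶠ a in 𝓝 y, |y - a| * d + |y - a| * d < ε :=
      Continuous.tendsto' (by fun_prop) _ _ (by simp) |>.eventually_lt_const hε
    obtain ⟨a, ha⟩ := Rat.denseRange_cast.mem_nhds hnear
    filter_upwards [((hfd a).add (hgd.const_mul |y - a|)).eventually_lt_const ha,
      self_mem_nhdsWithin] with r hr (hr0 : 0 < r)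
    refine lt_of_le_of_lt ?_ hr
    rw [mul_left_comm |y - a|, ← mul_add]
    exact mul_le_mul_of_nonneg_left (hle a r) (inv_nonneg.mpr hr0.le)

theorem ae_tendsto_inv_mul_setIntegral_abs_sub_mul [IsFiniteMeasure μ] (hf : Measurable f)
    (hg : Measurable g) (hg0 : ∀ t, 0 ≤ g t) (hgi : Integrable g μ)
    (hfg : Integrable (fun t => |f t| * g t) μ) :
    ∀ᵐ x, Tendsto (fun r => r⁻¹ * ∫ t in Icc (x - r) (x + r), |f t - f x| * g t ∂μ)
      (𝓝[>] 0) (𝓝 0) := by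
  have hrat : ∀ᵐ x, ∀ a : ℚ, Tendsto
      (fun r => r⁻¹ * ∫ t in Icc (x - r) (x + r), |f t - a| * g t ∂μ) (𝓝[>] 0)
      (𝓝 (|f x - a| * (g x * (2 * (μ.rnDeriv volume x).toReal)))) :=
    ae_all_iff.mpr fun a => by
      simpa only [Pi.mul_apply, mul_assoc] using ae_tendsto_inv_mul_setIntegral_Icc
        ((hf.sub_const (a : ℝ)).abs.mul hg) (fun t => mul_nonneg (abs_nonneg _) (hg0 t))
        (integrable_abs_sub_mul hf.aestronglyMeasurable hgi hfg a)
  filter_upwards [hrat, ae_tendsto_inv_mul_setIntegral_Icc hg hg0 hgi] with x hfx hgx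
  exact tendsto_inv_mul_setIntegral_abs_sub_mul_of_forall_rat hf.aestronglyMeasurable hgi hfg
    (ae_of_all _ hg0) hgx hfx

-- `f x` itself may be the wrong centre: `f` is only determined up to a `μ`-null set.
theorem ae_exists_tendsto_inv_mul_setIntegral_abs_sub_mul [IsFiniteMeasure μ]
    (hf : AEStronglyMeasurable f μ) (hg : Integrable g μ)
    (hfg : Integrable (fun t => |f t| * g t) μ) (hg0 : 0 ≤ᵐ[μ] g) :
    ∀ᵐ x, ∃ c, Tendsto (fun r => r⁻¹ * ∫ t in Icc (x - r) (x + r), |f t - c| * g t ∂μ)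
      (𝓝[>] 0) (𝓝 0) := by
  set f' := hf.mk f
  set g' : ℝ → ℝ := fun t => |hg.aestronglyMeasurable.mk g t|
  have hff : f =ᵐ[μ] f' := hf.ae_eq_mk
  have hgg : g =ᵐ[μ] g' := by
    filter_upwards [hg.aestronglyMeasurable.ae_eq_mk, hg0] with t ht ht0
    simp only [g', ← ht, abs_of_nonneg ht0]
  have hcongr : ∀ c, (fun t => |f t - c| * g t) =ᵐ[μ] fun t => |f' t - c| * g' t := fun c => by
    filter_upwards [hff, hgg] with t hft hgt
    rw [hft, hgt]
  have hfg' : Integrable (fun t => |f' t| * g' t) μ :=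
    hfg.congr (by simpa only [sub_zero] using hcongr 0)
  filter_upwards [ae_tendsto_inv_mul_setIntegral_abs_sub_mul hf.stronglyMeasurable_mk.measurable
    hg.aestronglyMeasurable.stronglyMeasurable_mk.measurable.abs (fun t => abs_nonneg _)
    (hg.congr hgg) hfg'] with x hx
  exact ⟨f' x, hx.congr fun r => by rw [integral_congr_ae (ae_restrict_of_ae (hcongr _))]⟩

theorem IsLebesguePoint.tendsto_inv_mul_setIntegral_abs_sub_mul [IsFiniteMeasure μ] {x : ℝ}
    (hx : IsLebesguePoint μ f x) (hf : Integrable f μ) (hg0 : 0 ≤ᵐ[μ] g)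
    (hg : (𝓝 x).IsBoundedUnder (· ≤ ·) g) :
    Tendsto (fun r => r⁻¹ * ∫ t in Icc (x - r) (x + r), |f t - f x| * g t ∂μ) (𝓝[>] 0) (𝓝 0) := by
  obtain ⟨B, hB⟩ := hg
  obtain ⟨ρ, hρ, hball⟩ := Metric.nhds_basis_closedBall.mem_iff.mp (eventually_map.mp hB)
  have hlim : Tendsto (fun r => B * (r⁻¹ * ∫ t in Icc (x - r) (x + r), |f t - f x| ∂μ))
      (𝓝[>] 0) (𝓝 0) := by
    simpa only [mul_zero] using Tendsto.const_mul B hx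
  refine squeeze_zero' ?_ ?_ hlim
  · filter_upwards [self_mem_nhdsWithin] with r (hr : 0 < r)
    exact mul_nonneg (inv_nonneg.mpr hr.le) <| integral_nonneg_of_ae <|
      ae_restrict_of_ae <| hg0.mono fun t ht => mul_nonneg (abs_nonneg _) ht
  · filter_upwards [Ioc_mem_nhdsGT hρ] with r hr
    rw [mul_left_comm, ← integral_const_mul B]
    refine mul_le_mul_of_nonneg_left ?_ (inv_nonneg.mpr hr.1.le)
    refine integral_mono_of_nonneg
      (ae_restrict_of_ae (hg0.mono fun t ht => mul_nonneg (abs_nonneg _) ht))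
      ((hf.sub (integrable_const _)).abs.const_mul _).integrableOn
      (ae_restrict_of_forall_mem measurableSet_Icc fun t ht => ?_)
    rw [← Real.closedBall_eq_Icc] at ht
    exact (mul_comm _ _).trans_le <| mul_le_mul_of_nonneg_right
      (hball (Metric.closedBall_subset_closedBall hr.2 ht)) (abs_nonneg _)

theorem tendstoUniformlyOn_inv_mul_setIntegral_abs_sub_mul [IsLocallyFiniteMeasure μ]
    {K K' : Set ℝ} {δ G W : ℝ} (hδ : 0 < δ) (hK : ∀ x ∈ K, Metric.closedBall x δ ⊆ K')
    (hf : UniformContinuousOn f K') (hG : ∀ t ∈ K', |g t| ≤ G)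
    (hW : ∀ x ∈ K, ∀ r, 0 < r → r ≤ δ → μ.real (Icc (x - r) (x + r)) ≤ W * r) :
    TendstoUniformlyOn (fun r x => r⁻¹ * ∫ t in Icc (x - r) (x + r), |f t - f x| * g t ∂μ)
      0 (𝓝[>] 0) K := by
  rw [Metric.tendstoUniformlyOn_iff]
  intro ε hε
  obtain ⟨ρ, hρ, hosc⟩ := Metric.uniformContinuousOn_iff.mp hf (ε / (|G| * |W| + 1)) (by positivity)
  filter_upwards [Ioc_mem_nhdsGT hδ, Ioo_mem_nhdsGT hρ] with r hrδ hrρ x hx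
  have hr : 0 < r := hrδ.1
  have hball : Icc (x - r) (x + r) ⊆ K' := by
    rw [← Real.closedBall_eq_Icc]
    exact (Metric.closedBall_subset_closedBall hrδ.2).trans (hK x hx)
  have hxK : x ∈ K' := hK x hx (Metric.mem_closedBall_self hδ.le)
  have hbound : ∀ t ∈ Icc (x - r) (x + r),
      ‖|f t - f x| * g t‖ ≤ ε / (|G| * |W| + 1) * |G| := fun t ht => by
    rw [norm_mul, Real.norm_eq_abs, abs_abs, Real.norm_eq_abs]
    have hdist : dist t x < ρ := by
      rw [← Real.closedBall_eq_Icc] at ht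
      exact ht.trans_lt hrρ.2
    exact mul_le_mul (hosc t (hball ht) x hxK hdist).le ((hG t (hball ht)).trans (le_abs_self G))
      (abs_nonneg _) (by positivity)
  have hint := norm_setIntegral_le_of_norm_le_const (isCompact_Icc.measure_lt_top (μ := μ)) hbound
  rw [Pi.zero_apply, dist_zero_left, norm_mul, Real.norm_of_nonneg (inv_nonneg.mpr hr.le),
    inv_mul_lt_iff₀ hr]
  calc _ ≤ _ := hint
    _ ≤ ε / (|G| * |W| + 1) * |G| * (|W| * r) := by
      gcongr
      exact (hW x hx r hr hrδ.2).trans (by gcongr; exact le_abs_self W)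
    _ = r * (ε * ((|G| * |W|) / (|G| * |W| + 1))) := by ring
    _ < r * ε := by
      refine mul_lt_mul_of_pos_left (mul_lt_of_lt_one_right hε ?_) hr
      rw [div_lt_one (by positivity)]
      exact lt_add_one _

theorem measureReal_Icc_le_of_withDensity_le {ω : ℝ → ℝ} {x r W : ℝ}
    (hμ : μ ≤ volume.withDensity fun t => ENNReal.ofReal (ω t)) (hr : 0 ≤ r) (hW0 : 0 ≤ W)
    (hW : ∀ t ∈ Icc (x - r) (x + r), ω t ≤ W) : μ.real (Icc (x - r) (x + r)) ≤ 2 * W * r := by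
  refine ENNReal.toReal_le_of_le_ofReal (by positivity) ?_
  calc μ (Icc (x - r) (x + r)) ≤ ∫⁻ t in Icc (x - r) (x + r), ENNReal.ofReal (ω t) := by
        grw [hμ, withDensity_apply _ measurableSet_Icc]
    _ ≤ ∫⁻ _ in Icc (x - r) (x + r), ENNReal.ofReal W :=
        setLIntegral_mono' measurableSet_Icc fun t ht => ENNReal.ofReal_le_ofReal (hW t ht)
    _ = ENNReal.ofReal (2 * W * r) := by
        rw [setLIntegral_const, Real.volume_Icc, ← ENNReal.ofReal_mul hW0]
        ring_nf

theorem tendstoUniformlyOn_closedBall_inv_mul_setIntegral_abs_sub_mul [IsLocallyFiniteMeasure μ]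
    {ω : ℝ → ℝ} (hμ : μ ≤ volume.withDensity fun t => ENNReal.ofReal (ω t)) {x R G W : ℝ}
    (hR : 0 < R) (hf : ContinuousOn f (Metric.closedBall x R))
    (hG : ∀ t ∈ Metric.closedBall x R, |g t| ≤ G) (hW : ∀ t ∈ Metric.closedBall x R, ω t ≤ W) :
    TendstoUniformlyOn (fun r y => r⁻¹ * ∫ t in Icc (y - r) (y + r), |f t - f y| * g t ∂μ)
      0 (𝓝[>] 0) (Metric.closedBall x (R / 2)) := by
  have hsub : ∀ y ∈ Metric.closedBall x (R / 2), Metric.closedBall y (R / 2) ⊆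
      Metric.closedBall x R := fun y hy =>
    Metric.closedBall_subset_closedBall' (by linarith [Metric.mem_closedBall.mp hy])
  refine tendstoUniformlyOn_inv_mul_setIntegral_abs_sub_mul (half_pos hR) hsub
    ((isCompact_closedBall x R).uniformContinuousOn_of_continuous hf) hG fun y hy r hr hrR =>
    measureReal_Icc_le_of_withDensity_le hμ hr.le (abs_nonneg W) fun t ht => ?_
  rw [← Real.closedBall_eq_Icc] at ht
  exact (hW t (hsub y hy (Metric.closedBall_subset_closedBall hrR ht))).trans (le_abs_self W)

theorem exists_closedBall_tendstoUniformlyOn_inv_mul_setIntegral_abs_sub_mul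
    [IsLocallyFiniteMeasure μ] {ω : ℝ → ℝ}
    (hμ : μ ≤ volume.withDensity fun t => ENNReal.ofReal (ω t)) {U : Set ℝ} {x : ℝ} (hU : U ∈ 𝓝 x)
    (hf : ContinuousOn f U) (hg0 : ∀ t ∈ U, 0 ≤ g t) (hg : (𝓝 x).IsBoundedUnder (· ≤ ·) g)
    (hω : (𝓝 x).IsBoundedUnder (· ≤ ·) ω) :
    ∃ ρ > 0, Metric.closedBall x ρ ⊆ U ∧ (∃ G, ∀ t ∈ Metric.closedBall x ρ, g t ≤ G) ∧
      TendstoUniformlyOn (fun r y => r⁻¹ * ∫ t in Icc (y - r) (y + r), |f t - f y| * g t ∂μ)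
        0 (𝓝[>] 0) (Metric.closedBall x ρ) := by
  obtain ⟨G, hG⟩ := hg
  obtain ⟨W, hW⟩ := hω
  obtain ⟨R, hR, hball⟩ := Metric.nhds_basis_closedBall.mem_iff.mp
    (inter_mem hU (inter_mem (eventually_map.mp hG) (eventually_map.mp hW)))
  have hhalf := Metric.closedBall_subset_closedBall (x := x) (half_le_self hR.le)
  refine ⟨R / 2, half_pos hR, fun t ht => (hball (hhalf ht)).1,
    ⟨G, fun t ht => (hball (hhalf ht)).2.1⟩, ?_⟩
  refine tendstoUniformlyOn_closedBall_inv_mul_setIntegral_abs_sub_mul (G := G) hμ hR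
    (hf.mono fun t ht => (hball ht).1) (fun t ht => ?_) fun t ht => (hball ht).2.2
  rw [abs_of_nonneg (hg0 t (hball ht).1)]
  exact (hball ht).2.1

end LebesguePoints

section Majorant

open Polynomial

theorem integrable_of_integrable_rpow {α : Type*} [MeasurableSpace α] {μ : Measure α}
    [IsFiniteMeasure μ] {g : α → ℝ} {p : ℝ} (hp : 1 ≤ p) (hg0 : ∀ t, 0 ≤ g t)
    (hg : Integrable (fun t => g t ^ p) μ) : Integrable g μ := by
  have hmeas : AEStronglyMeasurable g μ :=
    ((hg.aestronglyMeasurable.aemeasurable.pow_const p⁻¹).congr <| ae_of_all _ fun t =>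
      Real.rpow_rpow_inv (hg0 t) (by positivity)).aestronglyMeasurable
  refine (hg.add (integrable_const (1 : ℝ))).mono' hmeas (ae_of_all _ fun t => ?_)
  rw [Real.norm_of_nonneg (hg0 t), Pi.add_apply]
  rcases le_total (g t) 1 with h | h
  · exact h.trans (le_add_of_nonneg_left (Real.rpow_nonneg (hg0 t) p))
  · exact (Real.self_le_rpow_of_one_le h hp).trans (le_add_of_nonneg_right zero_le_one)

namespace SobolevData

variable {S : SobolevData} {q : ℕ → ℝ[X]} {f h : ℝ → ℝ}

theorem MemR.mono_exponent {p r : ℝ} (hf : S.MemR p f) (hrp : r ≤ p) : S.MemR r f :=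
  ⟨hf.1.mono_exponent (ENNReal.ofReal_le_ofReal hrp), hf.2⟩

theorem MemR.integrable (hf : S.MemR 1 f) : Integrable f S.θ := by
  simpa only [ENNReal.ofReal_one, memLp_one_iff_integrable] using hf.1

theorem summable_abs_recCoeff_sub (hrec : Summable fun s : ℕ =>
      ∑ j ∈ Finset.Icc 1 (S.N + 1), (j : ℝ) * ∑ l ∈ Finset.Icc 0 (S.N + 1),
        (|S.recCoeff q (s + j) j - S.recCoeff q (s + j + l) j| +
          |S.recCoeff q (s + l) l - S.recCoeff q (s + j + l) l|)) {l : ℕ} (hl : l ≤ S.N + 1) :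
    Summable fun s => |S.recCoeff q (s + l) l - S.recCoeff q (s + 1 + l) l| := by
  set d : ℕ → ℕ → ℕ → ℝ := fun s j l =>
    |S.recCoeff q (s + j) j - S.recCoeff q (s + j + l) j| +
      |S.recCoeff q (s + l) l - S.recCoeff q (s + j + l) l|
  have hd0 : ∀ s j l, 0 ≤ d s j l := fun s j l => by positivity
  refine .of_nonneg_of_le (fun _ => abs_nonneg _) (fun s => ?_) hrec
  calc |S.recCoeff q (s + l) l - S.recCoeff q (s + 1 + l) l|
      ≤ d s 1 l := le_add_of_nonneg_left (abs_nonneg _)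
    _ ≤ ∑ l ∈ Finset.Icc 0 (S.N + 1), d s 1 l :=
        Finset.single_le_sum (fun l _ => hd0 s 1 l) (Finset.mem_Icc.mpr ⟨l.zero_le, hl⟩)
    _ = (1 : ℕ) * ∑ l ∈ Finset.Icc 0 (S.N + 1), d s 1 l := by rw [Nat.cast_one, one_mul]
    _ ≤ ∑ j ∈ Finset.Icc 1 (S.N + 1), (j : ℝ) * ∑ l ∈ Finset.Icc 0 (S.N + 1), d s j l :=
        Finset.single_le_sum (f := fun j : ℕ => (j : ℝ) * ∑ l ∈ Finset.Icc 0 (S.N + 1), d s j l)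
          (fun j _ => mul_nonneg j.cast_nonneg (Finset.sum_nonneg fun l _ => hd0 s j l))
          (Finset.mem_Icc.mpr ⟨le_rfl, by omega⟩)

variable (S) in
theorem ae_mem_eps_or_eq : ∀ᵐ t ∂S.θ, t ∈ S.eps ∨ t = -1 ∨ t = 1 := by
  have ha : ∀ᵐ t ∂S.θ, ∀ k, t ≠ S.a k :=
    ae_all_iff.mpr fun k => compl_mem_ae_iff.mpr (S.θ_a k)
  filter_upwards [S.ae_mem_Icc, ha] with t ht hta
  by_cases hmem : t ∈ Ioo (-1 : ℝ) 1
  · exact .inl ⟨hmem, by rintro ⟨k, rfl⟩; exact hta k rfl⟩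
  · grind

namespace IsOrthonormalSystem

theorem exists_ae_eq_imp_abs_eval_le (hq : S.IsOrthonormalSystem q) (e : ℝ) :
    ∃ U, ∀ᵐ t ∂S.θ, t = e → ∀ j, |(q j).eval t| ≤ U := by
  by_cases he : S.θ {e} = 0
  · exact ⟨0, (measure_eq_zero_iff_ae_notMem.mp he).mono fun t ht hte => absurd hte ht⟩
  · obtain ⟨U, hU⟩ := hq.exists_abs_eval_le_of_measure_singleton_ne_zero he
    exact ⟨U, ae_of_all _ fun t ht => ht ▸ hU⟩

theorem exists_majorant (hq : S.IsOrthonormalSystem q)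
    (hbound : ∀ k, ∀ t ∈ S.eps, |(q k).eval t| ≤ h t) (hf : Integrable f S.θ)
    (hfh : Integrable (fun t => |f t| * |h t|) S.θ) (hh : Integrable (fun t => |h t|) S.θ) :
    ∃ g, EqOn g h S.eps ∧ Integrable g S.θ ∧ Integrable (fun t => |f t| * g t) S.θ ∧
      ∀ᵐ t ∂S.θ, ∀ j, |(q j).eval t| ≤ g t := by
  classical
  obtain ⟨U, hU⟩ := hq.exists_ae_eq_imp_abs_eval_le (-1)
  obtain ⟨V, hV⟩ := hq.exists_ae_eq_imp_abs_eval_le 1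
  have heps := S.isOpen_eps.measurableSet
  refine ⟨S.eps.piecewise (fun t => |h t|) fun _ => max U V, fun t ht => ?_,
    .piecewise heps hh.integrableOn (integrable_const _).integrableOn, ?_, ?_⟩
  · rw [piecewise_eq_of_mem _ _ _ ht, abs_of_nonneg ((abs_nonneg _).trans (hbound 0 t ht))]
  · refine (Integrable.piecewise heps hfh.integrableOn
      (hf.abs.mul_const (max U V)).integrableOn).congr (ae_of_all _ fun t => ?_)
    by_cases ht : t ∈ S.eps <;> simp [ht]
  · filter_upwards [S.ae_mem_eps_or_eq, hU, hV] with t ht hUt hVt j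
    by_cases hte : t ∈ S.eps
    · rw [piecewise_eq_of_mem _ _ _ hte]
      exact (hbound j t hte).trans (le_abs_self _)
    · rw [piecewise_eq_of_notMem _ _ _ hte]
      rcases ht.resolve_left hte with ht | ht
      · exact le_max_of_le_left (hUt ht j)
      · exact le_max_of_le_right (hVt ht j)

theorem exists_majorant_tendstoUniformlyOn_multSum (hq : S.IsOrthonormalSystem q)
    (hbound : ∀ k, ∀ t ∈ S.eps, |(q k).eval t| ≤ h t)
    (hBV : ∀ l ≤ S.N + 1,
      Summable fun s => |S.recCoeff q (s + l) l - S.recCoeff q (s + 1 + l) l|)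
    {φ : ℕ → ℝ} (hφ : Summable fun k : ℕ => ((k : ℝ) + 1) * |φ k - 2 * φ (k + 1) + φ (k + 2)|)
    (hlog : φ =O[atTop] fun k : ℕ => 1 / Real.log (k : ℝ)) (hf : Integrable f S.θ)
    (hfh : Integrable (fun t => |f t| * |h t|) S.θ) (hh : Integrable (fun t => |h t|) S.θ) :
    ∃ g, EqOn g h S.eps ∧ Integrable g S.θ ∧ Integrable (fun t => |f t| * g t) S.θ ∧
      0 ≤ᵐ[S.θ] g ∧ ∀ (K : Set ℝ) (c : ℝ → ℝ) (V B : ℝ), IsCompact K → K ⊆ S.eps →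
        (∀ x ∈ K, g x ≤ V) → (∀ x ∈ K, |c x| ≤ B) →
        TendstoUniformlyOn
          (fun r x => r⁻¹ * ∫ t in Icc (x - r) (x + r), |f t - c x| * g t ∂S.θ) 0 (𝓝[>] 0) K →
        TendstoUniformlyOn (S.multSum q φ f) (S.multLimit q φ f) atTop K := by
  obtain ⟨g, hgh, hg, hfg, hqg⟩ := hq.exists_majorant hbound hf hfh hh
  refine ⟨g, hgh, hg, hfg, hqg.mono fun t ht => (abs_nonneg _).trans (ht 0), ?_⟩
  intro K c V B hK hKS hV hc hLeb
  exact hq.tendstoUniformlyOn_multSum hBV hφ hlog hf hg hfg hqg hK hKS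
    (fun x hx j => (hbound j x (hKS hx)).trans (hgh (hKS hx) ▸ hV x hx)) hc hLeb

end IsOrthonormalSystem

end SobolevData

end Majorant

theorem theorem1_general (S : SobolevData) (q : ℕ → Polynomial ℝ) (hq : S.IsOrthonormalSystem q)
    (h : ℝ → ℝ) (hbound : ∀ k, ∀ t ∈ S.eps, |(q k).eval t| ≤ h t)
    (hBV : ∀ l ≤ S.N + 1,
      Summable fun s => |S.recCoeff q (s + l) l - S.recCoeff q (s + 1 + l) l|)
    (φ : ℕ → ℝ) (hφ : Summable fun k : ℕ => ((k : ℝ) + 1) * |φ k - 2 * φ (k + 1) + φ (k + 2)|)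
    (hlog : φ =O[atTop] fun k : ℕ => 1 / Real.log (k : ℝ))
    (f : ℝ → ℝ) (hf : S.MemR 1 f) (hfh : Integrable (fun t => |f t| * |h t|) S.θ)
    (hh : Integrable (fun t => |h t|) S.θ) :
    (∀ x ∈ S.eps, (𝓝 x).IsBoundedUnder (· ≤ ·) h → IsLebesguePoint S.θ f x →
      ∃ T : ℝ, Tendsto (fun n => S.multSum q φ f n x) atTop (𝓝 T)) ∧
    (∀ᵐ x ∂(volume : Measure ℝ), x ∈ S.eps →
      ∃ T : ℝ, Tendsto (fun n => S.multSum q φ f n x) atTop (𝓝 T)) ∧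
    (∀ ω : ℝ → ℝ, ContinuousOn f S.eps →
      (∀ x ∈ S.eps, (𝓝 x).IsBoundedUnder (· ≤ ·) h) →
      (∀ x ∈ S.eps, (𝓝 x).IsBoundedUnder (· ≤ ·) ω) →
      S.θ ≤ volume.withDensity (fun x => ENNReal.ofReal (ω x)) →
      ∃ T : ℝ → ℝ, ∀ K ⊆ S.eps, IsCompact K →
        TendstoUniformlyOn (fun n x => S.multSum q φ f n x) T atTop K) := by
  obtain ⟨g, hgh, hg, hfg, hg0, hconv⟩ :=
    hq.exists_majorant_tendstoUniformlyOn_multSum hbound hBV hφ hlog hf.integrable hfh hh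
  have hgbdd : ∀ x ∈ S.eps, (𝓝 x).IsBoundedUnder (· ≤ ·) h → (𝓝 x).IsBoundedUnder (· ≤ ·) g :=
    fun x hx hb => hb.mono_le (hgh.eventuallyEq_of_mem (S.isOpen_eps.mem_nhds hx)).le
  have hpoint : ∀ x ∈ S.eps, ∀ c : ℝ,
      Tendsto (fun r => r⁻¹ * ∫ t in Icc (x - r) (x + r), |f t - c| * g t ∂S.θ) (𝓝[>] 0) (𝓝 0) →
      ∃ T : ℝ, Tendsto (fun n => S.multSum q φ f n x) atTop (𝓝 T) := fun x hx c hc =>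
    ⟨_, tendstoUniformlyOn_singleton_iff_tendsto.mp <| hconv {x} (fun _ => c) (g x) |c|
      isCompact_singleton (singleton_subset_iff.mpr hx) (by simp) (by simp)
      (tendstoUniformlyOn_singleton_iff_tendsto.mpr hc)⟩
  refine ⟨fun x hx hb hLeb => ?_, ?_, fun ω hfc hb hω hθ => ⟨S.multLimit q φ f, ?_⟩⟩
  · exact hpoint x hx (f x) <|
      hLeb.tendsto_inv_mul_setIntegral_abs_sub_mul hf.integrable hg0 (hgbdd x hx hb)
  · filter_upwards [ae_exists_tendsto_inv_mul_setIntegral_abs_sub_mul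
      hf.integrable.aestronglyMeasurable hg hfg hg0] with x ⟨c, hc⟩ hx
    exact hpoint x hx c hc
  · rw [← tendstoLocallyUniformlyOn_iff_forall_isCompact S.isOpen_eps]
    refine tendstoLocallyUniformlyOn_of_forall_exists_nhds fun x hx => ?_
    obtain ⟨ρ, hρ, hsub, ⟨G, hG⟩, hLeb⟩ :=
      exists_closedBall_tendstoUniformlyOn_inv_mul_setIntegral_abs_sub_mul hθ
        (S.isOpen_eps.mem_nhds hx) hfc
        (fun t ht => hgh ht ▸ (abs_nonneg _).trans (hbound 0 t ht)) (hgbdd x hx (hb x hx)) (hω x hx)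
    have hK := isCompact_closedBall x ρ
    obtain ⟨B, hB⟩ := hK.exists_bound_of_continuousOn (hfc.mono hsub)
    exact ⟨_, mem_nhdsWithin_of_mem_nhds (Metric.closedBall_mem_nhds x hρ),
      hconv _ f G B hK hsub hG hB hLeb⟩

theorem theorem1 (S : SobolevData) (q : ℕ → Polynomial ℝ) (hq : S.IsOrthonormalSystem q)
    (h : ℝ → ℝ) (hbound : ∀ k, ∀ t ∈ S.eps, |(q k).eval t| ≤ h t)
    (hrec : Summable fun s : ℕ =>
      ∑ j ∈ Finset.Icc 1 (S.N + 1), (j : ℝ) * ∑ l ∈ Finset.Icc 0 (S.N + 1),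
        (|S.recCoeff q (s + j) j - S.recCoeff q (s + j + l) j| +
          |S.recCoeff q (s + l) l - S.recCoeff q (s + j + l) l|))
    (φ : ℕ → ℝ) (hφ : IsQuasiconvex φ)
    (hlog : φ =O[atTop] fun k : ℕ => 1 / Real.log (k : ℝ))
    (p : ℝ) (hp : 1 ≤ p) (f : ℝ → ℝ) (hf : S.MemR p f)
    (hfh : Integrable (fun t => |f t| ^ p * |h t| ^ p) S.θ)
    (hh : Integrable (fun t => |h t| ^ p) S.θ) :
    -- convergence at Lebesgue points
    (∀ x ∈ S.eps, (𝓝 x).IsBoundedUnder (· ≤ ·) h → IsLebesguePoint S.θ f x →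
      ∃ T : ℝ, Tendsto (fun n => S.multSum q φ f n x) atTop (𝓝 T)) ∧
    -- convergence almost everywhere
    (∀ᵐ x ∂(volume : Measure ℝ), x ∈ S.eps →
      ∃ T : ℝ, Tendsto (fun n => S.multSum q φ f n x) atTop (𝓝 T)) ∧
    -- uniform convergence on compact subsets
    (∀ ω : ℝ → ℝ, ContinuousOn f (Icc (-1) 1) →
      (∀ x ∈ S.eps, (𝓝 x).IsBoundedUnder (· ≤ ·) h) →
      ContinuousOn ω S.eps → (∀ x ∈ S.eps, 0 ≤ ω x) →
      S.θ = (volume.restrict (Icc (-1) 1)).withDensity (fun x => ENNReal.ofReal (ω x)) →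
      ∃ T : ℝ → ℝ, ∀ K ⊆ S.eps, IsCompact K →
        TendstoUniformlyOn (fun n x => S.multSum q φ f n x) T atTop K) := by
  obtain ⟨hLeb, hae, hunif⟩ := theorem1_general S q hq h hbound
    (fun l hl => SobolevData.summable_abs_recCoeff_sub hrec hl) φ hφ.2 hlog f (hf.mono_exponent hp)
    (integrable_of_integrable_rpow hp (fun t => by positivity)
      (by simpa only [Real.mul_rpow, abs_nonneg] using hfh))
    (integrable_of_integrable_rpow hp (fun t => abs_nonneg _) hh)
  refine ⟨hLeb, hae, fun ω hfc hb hω _ hθ => hunif ω (hfc.mono S.eps_subset_Icc) hb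
    (fun x hx => (hω.continuousAt (S.isOpen_eps.mem_nhds hx)).isBoundedUnder_le) ?_⟩
  rw [hθ, ← restrict_withDensity measurableSet_Icc]
  exact Measure.restrict_le_self
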